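/- Let $$X_t=\int_0^t\gamma_u\,du+\int_0^t\sigma_u\,dW_u+\sum_{j=1}^{N_t}\zeta_j,\qquad t\ge 0,$$ where $W$ is a standard Wiener process, $N$ is a non-homogeneous Poisson process with intensity function $\lambda$, the $\zeta_j$ are i.i.d. with density $f$, and $W$, $N$, $(\zeta_j)_{j\ge1}$ are independent. The functions $\gamma,\sigma,\lambda$ on $[0,\infty)$ are deterministic and measurable, each has a positive infimum and a finite supremum on $[0,t]$ for every $t>0$, and $\sigma$ is continuous. The density has the form $f(x)=p f_+(x)\mathbf 1_{\{x\ge 0\}}+(1-p)f_-(x)\mathbf 1_{\{x<0\}}$ with $p\in[0,1]$ and bounded functions $f_+:[0,\infty)\to[0,\infty)$, $f_-:(-\infty,0]\to[0,\infty)$ such that $\int_0^\infty f_+=\int_{-\infty}^0 f_-=1$, $f_\pm(0)=\lim_{x\to0^\pm}f_\pm(x)\in(0,\infty)$, $f_+\in C^1([0,b))$ and $f_-\in C^1((a,0])$ for some $a<0<b$, and $\lim_{x\to0^\pm}f_\pm'(x)$ exist. Fix $T>0$ and let $h_n=T/n$, $t_i=ih_n$, $\Delta_iX=X_{t_i}-X_{t_{i-1}}$.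 For thresholds $B=(B_{n,i})_{1\le i\le n}$ put $$TRV_n(B)=\sum_{i=1}^n(\Delta_iX)^2\,\mathbf 1_{\{|\Delta_iX|\le B_{n,i}\}},\qquad K=\int_0^T(\gamma_s^2-\lambda_s\sigma_s^2)\,ds .$$ (1) If $B_{n,i}=\sqrt{3\sigma_{t_i}^2h_n\log(1/h_n)}$, then $TRV_n(B)$ is square integrable and, as $n\to\infty$, $$\mathbb E[TRV_n(B)]-\int_0^T\sigma_s^2\,ds=h_nK+o(h_n),\qquad \operatorname{Var}(TRV_n(B))\sim 2h_n\int_0^T\sigma_s^4\,ds ;$$ in particular, if $K\neq0$, then $\mathbb E[TRV_n(B)]-\int_0^T\sigma_s^2\,ds\sim h_nK$. Here $a_n\sim b_n$ means $a_n/b_n\to1$. (2) The same conclusions hold for all deterministic thresholds of the form $$B_{n,i}=\sqrt{c_{n,i}\,\sigma_{t_i}^2h_n\log(1/h_n)}+r_{n,i},\qquad \max_{1\le i\le n}|r_{n,i}|=o\big(\sqrt{h_n\log(1/h_n)}\big),$$ provided that $\liminf_{n\to\infty}\min_{1\le i\le n}c_{n,i}>2$ and $\limsup_{n\to\infty}\max_{1\le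 i\le n}c_{n,i}<\infty$. -/

import Mathlib

open MeasureTheory ProbabilityTheory Filter Topology
open scoped NNReal ENNReal

noncomputable section

namespace JumpDiffusion

/-! ### The coefficients and the jump density -/

/-- On every bounded interval `[0, t]`, the function `g` has a positive infimum and a finite
supremum. -/
def PositiveLocallyBounded (g : ℝ → ℝ) : Prop :=
  ∀ t : ℝ, 0 < t → ∃ m M : ℝ, 0 < m ∧ ∀ s ∈ Set.Icc 0 t, m ≤ g s ∧ g s ≤ M

/-- The conditions on the deterministic drift `γ`, volatility `σ` and intensity `lam`, which are
functions on `[0, ∞)` (their values at negative reals are never used). -/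
structure CoefficientConditions (γ σ lam : ℝ → ℝ) : Prop where
  drift_measurable : AEStronglyMeasurable γ (volume.restrict (Set.Ici 0))
  intensity_measurable : AEStronglyMeasurable lam (volume.restrict (Set.Ici 0))
  drift_bounds : PositiveLocallyBounded γ
  volatility_bounds : PositiveLocallyBounded σ
  intensity_bounds : PositiveLocallyBounded lam
  volatility_continuous : ContinuousOn σ (Set.Ici 0)

/-- `f(x) = p f₊(x) 1_{x ≥ 0} + (1 - p) f₋(x) 1_{x < 0}`. -/
def mixtureDensity (p : ℝ) (fp fm : ℝ → ℝ) (x : ℝ) : ℝ :=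
  if 0 ≤ x then p * fp x else (1 - p) * fm x

/-- The conditions on the weight `p` and on the one-sided densities `f₊` on `[0, ∞)` and `f₋` on
`(-∞, 0]`. -/
structure JumpDensityConditions (p : ℝ) (fp fm : ℝ → ℝ) : Prop where
  weight_mem : p ∈ Set.Icc (0 : ℝ) 1
  nonneg_pos : ∀ x, 0 ≤ x → 0 ≤ fp x
  nonneg_neg : ∀ x, x ≤ 0 → 0 ≤ fm x
  bounded_pos : ∃ M : ℝ, ∀ x, 0 ≤ x → fp x ≤ M
  bounded_neg : ∃ M : ℝ, ∀ x, x ≤ 0 → fm x ≤ M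
  integrable_pos : IntegrableOn fp (Set.Ici 0)
  integrable_neg : IntegrableOn fm (Set.Iic 0)
  integral_pos : ∫ x in Set.Ici (0 : ℝ), fp x = 1
  integral_neg : ∫ x in Set.Iic (0 : ℝ), fm x = 1
  tendsto_pos : Tendsto fp (𝓝[>] 0) (𝓝 (fp 0))
  tendsto_neg : Tendsto fm (𝓝[<] 0) (𝓝 (fm 0))
  zero_pos : 0 < fp 0
  zero_neg : 0 < fm 0
  contDiff_pos : ∃ b : ℝ, 0 < b ∧ ContDiffOn ℝ 1 fp (Set.Ico 0 b)
  contDiff_neg : ∃ a : ℝ, a < 0 ∧ ContDiffOn ℝ 1 fm (Set.Ioc a 0)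
  deriv_pos : ∃ l : ℝ, Tendsto (deriv fp) (𝓝[>] 0) (𝓝 l)
  deriv_neg : ∃ l : ℝ, Tendsto (deriv fm) (𝓝[<] 0) (𝓝 l)

/-! ### The Wiener integral of a deterministic function -/

/-- The step function `∑_{k < size} coeff k · 1_{(knot k, knot (k+1)]}` on `[0, ∞)`. -/
structure StepFunction where
  size : ℕ
  knot : ℕ → ℝ≥0
  knot_mono : Monotone knot
  coeff : ℕ → ℝ

/-- The value of a step function at `u`. -/
def StepFunction.eval (φ : StepFunction) (u : ℝ) : ℝ :=
  ∑ k ∈ Finset.range φ.size,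
    φ.coeff k * (Set.Ioc (φ.knot k : ℝ) (φ.knot (k + 1))).indicator 1 u

variable {Ω : Type*} [MeasurableSpace Ω]

/-- The elementary integral `∫_0^t φ dW` of a step function. -/
def StepFunction.integral (φ : StepFunction) (W : ℝ≥0 → Ω → ℝ) (t : ℝ≥0) (ω : Ω) : ℝ :=
  ∑ k ∈ Finset.range φ.size,
    φ.coeff k * (W (min (φ.knot (k + 1)) t) ω - W (min (φ.knot k) t) ω)

/-- `I t = ∫_0^t g dW` for all `t`, for a deterministic `g`: there are step functions that converge
to `g` in `L²([0, t])` for every `t`, and whose elementary integrals converge to `I t` in `L²(P)`.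
This determines every `I t` almost surely. -/
def IsWienerIntegral (g : ℝ → ℝ) (W I : ℝ≥0 → Ω → ℝ) (P : Measure Ω) : Prop :=
  ∃ φ : ℕ → StepFunction, ∀ t : ℝ≥0,
    MemLp (I t) 2 P ∧
    Tendsto (fun k ↦ eLpNorm (fun u ↦ (φ k).eval u - g u) 2
      (volume.restrict (Set.Ioc (0 : ℝ) t))) atTop (𝓝 0) ∧
    Tendsto (fun k ↦ eLpNorm (fun ω ↦ (φ k).integral W t ω - I t ω) 2 P) atTop (𝓝 0)

/-! ### The process -/

/-- `N` is a non-homogeneous Poisson process with intensity function `lam`. -/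
structure IsPoissonProcess (lam : ℝ → ℝ) (N : ℝ≥0 → Ω → ℕ) (P : Measure Ω) : Prop where
  measurable : ∀ t, Measurable (N t)
  zero : ∀ᵐ ω ∂P, N 0 ω = 0
  monotone : ∀ᵐ ω ∂P, Monotone fun t ↦ N t ω
  rightContinuous : ∀ᵐ ω ∂P, ∀ t, ContinuousWithinAt (fun s ↦ N s ω) (Set.Ici t) t
  indepIncrements : HasIndepIncrements (fun t ω ↦ (N t ω : ℝ)) P
  hasLaw : ∀ s t : ℝ≥0, s ≤ t →
    HasLaw (fun ω ↦ (N t ω : ℝ) - N s ω)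
      ((poissonMeasure (∫ u in (s : ℝ)..t, lam u).toNNReal).map (Nat.cast : ℕ → ℝ)) P

/-- `X_t = ∫_0^t γ_u du + ∫_0^t σ_u dW_u + ∑_{j ≤ N_t} ζ_j`, where `W` is a Wiener process, `N` is a
Poisson process with intensity function `lam`, the `ζ_j` are i.i.d. with density `f`, and `W`, `N`
and `(ζ_j)` are independent. The jump sizes are numbered from `0` here. -/
def IsJumpDiffusion (γ σ lam f : ℝ → ℝ) (X : ℝ≥0 → Ω → ℝ) (P : Measure Ω) : Prop :=
  ∃ (W I : ℝ≥0 → Ω → ℝ) (N : ℝ≥0 → Ω → ℕ) (ζ : ℕ → Ω → ℝ),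
    (∀ t, Measurable (W t)) ∧ IsBrownianReal W P ∧
    IsWienerIntegral σ W I P ∧
    IsPoissonProcess lam N P ∧
    (∀ j, Measurable (ζ j)) ∧ iIndepFun ζ P ∧
    (∀ j, HasLaw (ζ j) (volume.withDensity fun x ↦ ENNReal.ofReal (f x)) P) ∧
    IndepFun (fun ω t ↦ W t ω) (fun ω ↦ ((fun t ↦ N t ω), (fun j ↦ ζ j ω))) P ∧
    IndepFun (fun ω t ↦ N t ω) (fun ω j ↦ ζ j ω) P ∧
    ∀ t : ℝ≥0, ∀ᵐ ω ∂P,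
      X t ω = (∫ u in (0 : ℝ)..t, γ u) + I t ω + ∑ j ∈ Finset.range (N t ω), ζ j ω

/-! ### The thresholded realized variance -/

/-- The time span `h_n = T / n` between observations. -/
def mesh (T : ℝ≥0) (n : ℕ) : ℝ≥0 := T / n

/-- The observation time `t_i = i h_n`. -/
def obsTime (T : ℝ≥0) (n i : ℕ) : ℝ≥0 := i * mesh T n

/-- `√(h_n log (1 / h_n))`. -/
def thresholdRate (T : ℝ≥0) (n : ℕ) : ℝ :=
  √((mesh T n : ℝ) * Real.log (1 / (mesh T n : ℝ)))

/-- `TRV(X)[B] = ∑_{i=1}^n (Δ_i X)² 1_{|Δ_i X| ≤ B_i}`, with `Δ_i X = X_{t_i} - X_{t_{i-1}}`;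
the summand of index `i` below is the one of `Δ_{i+1} X`. -/
def trv (X : ℝ≥0 → Ω → ℝ) (T : ℝ≥0) (n : ℕ) (B : ℕ → ℝ) (ω : Ω) : ℝ :=
  ∑ i ∈ Finset.range n,
    if |X (obsTime T n (i + 1)) ω - X (obsTime T n i) ω| ≤ B (i + 1) then
      (X (obsTime T n (i + 1)) ω - X (obsTime T n i) ω) ^ 2
    else 0

/-- `a_n ∼ b_n`, that is, `a_n / b_n → 1`. -/
def AsympEquiv (a b : ℕ → ℝ) : Prop := Tendsto (fun n ↦ a n / b n) atTop (𝓝 1)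

/-- The bias `E[TRV(X)[B]] - ∫_0^T σ_s² ds` with the thresholds `B n 1, …, B n n`. -/
def trvBias (σ : ℝ → ℝ) (X : ℝ≥0 → Ω → ℝ) (P : Measure Ω) (T : ℝ≥0) (B : ℕ → ℕ → ℝ) (n : ℕ) : ℝ :=
  (∫ ω, trv X T n (B n) ω ∂P) - ∫ s in (0 : ℝ)..T, σ s ^ 2

/-- The asymptotic behaviour of the bias and variance of the thresholded realized variance. As
`a_n / b_n` is meaningless for `b_n = 0`, the relation `∼` for the bias is asserted when the
constant `K` is not zero, and its form `h_n K + o(h_n)` is asserted for every value of `K`. -/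
def TRVAsymptotics (γ σ lam : ℝ → ℝ) (X : ℝ≥0 → Ω → ℝ) (P : Measure Ω) (T : ℝ≥0)
    (B : ℕ → ℕ → ℝ) : Prop :=
  let K : ℝ := ∫ s in (0 : ℝ)..T, (γ s ^ 2 - lam s * σ s ^ 2)
  (∀ n, MemLp (trv X T n (B n)) 2 P) ∧
  (K ≠ 0 → AsympEquiv (trvBias σ X P T B) (fun n ↦ mesh T n * K)) ∧
  (fun n ↦ trvBias σ X P T B n - mesh T n * K) =o[atTop] (fun n ↦ (mesh T n : ℝ)) ∧
  AsympEquiv (fun n ↦ variance (trv X T n (B n)) P)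
    (fun n ↦ 2 * mesh T n * ∫ s in (0 : ℝ)..T, σ s ^ 4)

end JumpDiffusion

end

/-! Over a cell of length `h` the increment is `Δ = g + G + (jumps)`, where the drift `g`, the
variance `v` of the centred Gaussian `G` and the mean number of jumps `L` are all of order `h`. The
event of no jump is independent of `G` and has probability `e^{-L} = 1 - L + O(h²)`; on it the
truncated square has mean `v + g²` up to the effect of truncation. Hence a cell contributes `v + g²
- L v + o(h²)`. The `v` add up exactly to `∫ σ²`, while `∑ g² / h → ∫ γ²` and `∑ L v / h → ∫ λ σ²`,
which gives `K`.

Three errors must be `o(h²)` per cell. A single jump leaving `|Δ| ≤ B` has to land in an interval of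
length `2B`; the jump density is bounded, so this costs `O(B³ L) = O(h^{5/2} log^{3/2}(1/h))`. Two
or more jumps cost `O(B² L²)`. Truncating the Gaussian part matters only when `G² > κ v log (1/h)`,
and weighting by `exp (a G² / v)` with `a < 1/2` bounds this by `O(h^{1+q})`, `q = a κ`. A choice
with `q > 1` exists exactly when `κ > 2`: this is the origin of the constant `2`.

For the variance, the comparison is with `A = ∑ (g + G)²`, whose summands are independent and whose
variance `∑ (2 v² + 4 g² v)` is equivalent to `2 h ∫ σ⁴`. The difference is at most `max B²` times
the number of jumps plus the truncation remainders, so its second moment is `O(h² log²(1/h)) +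
O(h^q) = o(h)`, and Cauchy–Schwarz disposes of the covariance.

The argument rests on `IsWienerIntegral.integral_cexp_increments` (law and independence of the `G`),
`abs_integral_truncSq_sub_le` (mean over one cell), `exists_tail_rate` (Gaussian tail),
`integral_sq_difference_le` (comparison for the variance), `tendsto_sum_integral_mul_integral`
(Riemann sums for merely measurable coefficients) and `exists_isAdmissibleThreshold`. -/

namespace JumpDiffusion

/-! ### Wiener integrals of deterministic functions: Gaussian, independent increments -/

section WienerIntegral

variable {Ω : Type*} [MeasurableSpace Ω] {P : Measure Ω} {W : ℝ≥0 → Ω → ℝ}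

lemma covariance_brownian_increments (hW : IsPreBrownianReal W P) {a b c d : ℝ≥0}
    (hab : a ≤ b) (hcd : c ≤ d) :
    cov[fun ω ↦ W b ω - W a ω, fun ω ↦ W d ω - W c ω; P] =
      volume.real (Set.Ioc (a : ℝ) b ∩ Set.Ioc (c : ℝ) d) := by
  have := hW.isGaussianProcess.isProbabilityMeasure
  have h2 (t : ℝ≥0) : MemLp (W t) 2 P := (hW.isGaussianProcess.hasGaussianLaw_eval t).memLp_two
  rw [covariance_fun_sub_fun_sub (h2 b) (h2 a) (h2 d) (h2 c)]
  simp only [hW.covariance_eval]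
  rw [Set.Ioc_inter_Ioc, Measure.real, Real.volume_Ioc, ENNReal.toReal_ofReal']
  have hab' : (a : ℝ) ≤ b := hab
  have hcd' : (c : ℝ) ≤ d := hcd
  push_cast
  simp only [max_def, min_def]
  split_ifs <;> linarith

lemma Ioc_min_eq_inter (a b t : ℝ) :
    Set.Ioc (min a t) (min b t) = Set.Ioc a b ∩ Set.Iic t := by
  ext x
  simp only [Set.mem_Ioc, Set.mem_inter_iff, Set.mem_Iic, min_lt_iff, le_min_iff]
  constructor
  · rintro ⟨h1 | h1, h2, h3⟩
    · exact ⟨⟨h1, h2⟩, h3⟩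
    · exact absurd h3 (not_le.2 h1)
  · rintro ⟨⟨h1, h2⟩, h3⟩
    exact ⟨Or.inl h1, h2, h3⟩

lemma StepFunction.measurable_eval (φ : StepFunction) : Measurable φ.eval := by
  unfold StepFunction.eval
  refine Finset.measurable_sum _ fun k _ ↦ Measurable.const_mul ?_ _
  exact measurable_one.indicator measurableSet_Ioc

lemma StepFunction.memLp_eval (φ : StepFunction) (a b : ℝ) :
    MemLp φ.eval 2 (volume.restrict (Set.Ioc a b)) := by
  refine MemLp.of_bound φ.measurable_eval.aestronglyMeasurable
    (∑ k ∈ Finset.range φ.size, |φ.coeff k|) (.of_forall fun x ↦ ?_)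
  refine (Finset.abs_sum_le_sum_abs _ _).trans (Finset.sum_le_sum fun k _ ↦ ?_)
  rw [abs_mul]
  refine mul_le_of_le_one_right (abs_nonneg _) ?_
  by_cases hx : x ∈ Set.Ioc (φ.knot k : ℝ) (φ.knot (k + 1)) <;> simp [hx]

lemma StepFunction.integral_memLp (φ : StepFunction) (hW : IsPreBrownianReal W P) (t : ℝ≥0) :
    MemLp (φ.integral W t) 2 P := by
  have := hW.isGaussianProcess.isProbabilityMeasure
  have h2 (t : ℝ≥0) : MemLp (W t) 2 P := (hW.isGaussianProcess.hasGaussianLaw_eval t).memLp_two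
  exact memLp_finsetSum _ fun k _ ↦ ((h2 _).sub (h2 _)).const_mul _

/-- The Itô isometry for step functions: the covariance of two Brownian increments is the length of
the overlap of their intervals, that is, the integral of a product of indicators. Stopping at two
different times makes the formula yield variances and covariances of increments at once. -/
lemma StepFunction.covariance_integral (φ : StepFunction) (hW : IsPreBrownianReal W P)
    (t t' : ℝ≥0) :
    cov[φ.integral W t, φ.integral W t'; P] =
      ∫ x in Set.Ioc (0 : ℝ) (min t t' : ℝ≥0), φ.eval x ^ 2 := by
  have := hW.isGaussianProcess.isProbabilityMeasure
  have h2 (t : ℝ≥0) : MemLp (W t) 2 P := (hW.isGaussianProcess.hasGaussianLaw_eval t).memLp_two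
  have key (k l : ℕ) :
      cov[fun ω ↦ W (min (φ.knot (k + 1)) t) ω - W (min (φ.knot k) t) ω,
        fun ω ↦ W (min (φ.knot (l + 1)) t') ω - W (min (φ.knot l) t') ω; P] =
      ∫ x in Set.Ioc (0 : ℝ) (min t t' : ℝ≥0),
        (Set.Ioc (φ.knot k : ℝ) (φ.knot (k + 1))).indicator 1 x *
          (Set.Ioc (φ.knot l : ℝ) (φ.knot (l + 1))).indicator 1 x := by
    rw [covariance_brownian_increments hW
      (min_le_min_right _ (φ.knot_mono (Nat.le_succ k)))
      (min_le_min_right _ (φ.knot_mono (Nat.le_succ l)))]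
    push_cast
    rw [Ioc_min_eq_inter, Ioc_min_eq_inter]
    simp_rw [← Set.inter_indicator_mul, Pi.one_apply, mul_one]
    rw [integral_indicator (measurableSet_Ioc.inter measurableSet_Ioc), setIntegral_const,
      smul_eq_mul, mul_one, measureReal_restrict_apply (measurableSet_Ioc.inter measurableSet_Ioc)]
    congr 1
    ext x
    have : 0 ≤ (φ.knot k : ℝ) := (φ.knot k).2
    simp only [Set.mem_inter_iff, Set.mem_Ioc, Set.mem_Iic, le_min_iff]
    constructor
    · rintro ⟨⟨⟨h1, h2⟩, h3⟩, ⟨h4, h5⟩, h6⟩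
      exact ⟨⟨⟨h1, h2⟩, h4, h5⟩, by linarith, h3, h6⟩
    · rintro ⟨⟨⟨h1, h2⟩, h4, h5⟩, _, h3, h6⟩
      exact ⟨⟨⟨h1, h2⟩, h3⟩, ⟨h4, h5⟩, h6⟩
  unfold StepFunction.integral
  have hm (t : ℝ≥0) (k : ℕ) : MemLp (fun ω ↦ φ.coeff k *
      (W (min (φ.knot (k + 1)) t) ω - W (min (φ.knot k) t) ω)) 2 P :=
    ((h2 _).sub (h2 _)).const_mul _
  rw [covariance_fun_sum_fun_sum' (fun k _ ↦ hm t k) (fun k _ ↦ hm t' k)]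
  simp_rw [covariance_const_mul_left, covariance_const_mul_right, key, ← integral_const_mul]
  have hint (k l : ℕ) (a b : ℝ) : IntegrableOn (fun x : ℝ ↦ a * (b *
      ((Set.Ioc (φ.knot k : ℝ) (φ.knot (k + 1))).indicator 1 x *
          (Set.Ioc (φ.knot l : ℝ) (φ.knot (l + 1))).indicator 1 x)))
        (Set.Ioc (0 : ℝ) (min t t' : ℝ≥0)) := by
    refine Integrable.const_mul (Integrable.const_mul ?_ _) _
    simp_rw [← Set.inter_indicator_mul, Pi.one_apply, mul_one]
    refine (integrable_const (1 : ℝ)).indicator (measurableSet_Ioc.inter measurableSet_Ioc)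
  simp_rw [← integral_finsetSum _ (fun l _ ↦ hint _ l _ _)]
  rw [← integral_finsetSum _ (fun k _ ↦ integrable_finsetSum _ fun l _ ↦ hint k l _ _)]
  congr 1 with x
  rw [StepFunction.eval, sq, Finset.sum_mul_sum]
  exact Finset.sum_congr rfl fun k _ ↦ Finset.sum_congr rfl fun l _ ↦ by ring

lemma StepFunction.isGaussianProcess_integral (φ : StepFunction) (hW : IsPreBrownianReal W P) :
    IsGaussianProcess (φ.integral W) P := by
  refine hW.isGaussianProcess.of_isGaussianProcess fun t ↦ ?_
  let I : Finset ℝ≥0 := (Finset.range (φ.size + 1)).image fun k ↦ min (φ.knot k) t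
  have hm (k : Fin φ.size) : min (φ.knot k) t ∈ I :=
    Finset.mem_image.2 ⟨k, Finset.mem_range.2 (by omega), rfl⟩
  have hm' (k : Fin φ.size) : min (φ.knot (k + 1)) t ∈ I :=
    Finset.mem_image.2 ⟨k + 1, Finset.mem_range.2 (by omega), rfl⟩
  refine ⟨I, ∑ k : Fin φ.size, φ.coeff k •
    (ContinuousLinearMap.proj (R := ℝ) (φ := fun _ : I ↦ ℝ) ⟨_, hm' k⟩ -
      ContinuousLinearMap.proj (R := ℝ) (φ := fun _ : I ↦ ℝ) ⟨_, hm k⟩), fun ω ↦ ?_⟩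
  simp [StepFunction.integral, Finset.sum_range]

lemma StepFunction.integral_integral_eq_zero (φ : StepFunction) (hW : IsPreBrownianReal W P)
    (t : ℝ≥0) : P[φ.integral W t] = 0 := by
  unfold StepFunction.integral
  have hm (k : ℕ) : Integrable (fun ω ↦ φ.coeff k *
      (W (min (φ.knot (k + 1)) t) ω - W (min (φ.knot k) t) ω)) P :=
    ((hW.integrable_eval _).sub (hW.integrable_eval _)).const_mul _
  rw [integral_finsetSum _ fun k _ ↦ hm k]
  refine Finset.sum_eq_zero fun k _ ↦ ?_
  rw [integral_const_mul, integral_sub (hW.integrable_eval _) (hW.integrable_eval _)]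
  simp [hW.integral_eval]

lemma isGaussianProcess_increments {Y : ℝ≥0 → Ω → ℝ} (hY : IsGaussianProcess Y P) :
    IsGaussianProcess (fun (p : ℝ≥0 × ℝ≥0) ω ↦ Y p.2 ω - Y p.1 ω) P := by
  refine hY.of_isGaussianProcess fun p ↦ ?_
  refine ⟨{p.1, p.2}, ContinuousLinearMap.proj (R := ℝ) (φ := fun _ ↦ ℝ) ⟨p.2, by simp⟩ -
    ContinuousLinearMap.proj (R := ℝ) (φ := fun _ ↦ ℝ) ⟨p.1, by simp⟩, fun ω ↦ ?_⟩
  simp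

lemma integral_cexp_of_hasGaussianLaw {Z : Ω → ℝ} (hZ : HasGaussianLaw Z P) (h0 : P[Z] = 0) :
    ∫ ω, Complex.exp (Complex.I * (Z ω : ℂ)) ∂P = Complex.exp ((-(Var[Z; P] / 2) : ℝ) : ℂ) := by
  have h := hZ.charFun_map_eq (1 : ℝ)
  rw [charFun_apply_real, integral_map hZ.aemeasurable (by fun_prop)] at h
  simp only [Complex.ofReal_one, one_mul, Real.inner_apply] at h
  rw [h0] at h
  simp only [mul_comm Complex.I]
  rw [h]
  simp

/-- The two increments are jointly Gaussian and, by the isometry, uncorrelated, so any linear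
combination is a centred Gaussian whose variance is the weighted sum of the two. -/
lemma StepFunction.integral_cexp_increments (φ : StepFunction) (hW : IsPreBrownianReal W P)
    {s t s' t' : ℝ≥0} (hst : s ≤ t) (hts : t ≤ s') (hst' : s' ≤ t') (u w : ℝ) :
    ∫ ω, Complex.exp (Complex.I * ((u * (φ.integral W t ω - φ.integral W s ω) +
        w * (φ.integral W t' ω - φ.integral W s' ω) : ℝ) : ℂ)) ∂P =
      Complex.exp ((-((u ^ 2 * (∫ x in Set.Ioc (s : ℝ) t, φ.eval x ^ 2) +
        w ^ 2 * ∫ x in Set.Ioc (s' : ℝ) t', φ.eval x ^ 2) / 2) : ℝ) : ℂ) := by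
  have := hW.isGaussianProcess.isProbabilityMeasure
  have h2 (t : ℝ≥0) := φ.integral_memLp hW t
  have hd (s t : ℝ≥0) : MemLp (fun ω ↦ φ.integral W t ω - φ.integral W s ω) 2 P :=
    (h2 t).sub (h2 s)
  have hpair := (isGaussianProcess_increments
    (φ.isGaussianProcess_integral hW)).hasGaussianLaw_prodMk (s := (s, t)) (t := (s', t'))
  have hZ := hpair.map_fun (u • ContinuousLinearMap.fst ℝ ℝ ℝ + w • ContinuousLinearMap.snd ℝ ℝ ℝ)
  have hint (t : ℝ≥0) : Integrable (φ.integral W t) P := (h2 t).integrable one_le_two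
  have hzero (s t : ℝ≥0) : ∫ ω, φ.integral W t ω - φ.integral W s ω ∂P = 0 := by
    rw [integral_sub (hint t) (hint s), φ.integral_integral_eq_zero hW,
      φ.integral_integral_eq_zero hW, sub_zero]
  have hsq (a b : ℝ) : IntegrableOn (fun x ↦ φ.eval x ^ 2) (Set.Ioc a b) :=
    (φ.memLp_eval a b).integrable_sq
  have hF {a b : ℝ≥0} (hab : a ≤ b) : ∫ x in Set.Ioc (a : ℝ) b, φ.eval x ^ 2 =
      (∫ x in Set.Ioc (0 : ℝ) b, φ.eval x ^ 2) - ∫ x in Set.Ioc (0 : ℝ) a, φ.eval x ^ 2 := by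
    rw [← Set.Ioc_union_Ioc_eq_Ioc a.2 (NNReal.coe_le_coe.2 hab),
      setIntegral_union (Set.Ioc_disjoint_Ioc_of_le le_rfl) measurableSet_Ioc (hsq _ _) (hsq _ _)]
    exact (add_sub_cancel_left _ _).symm
  have hvar {s t : ℝ≥0} (hst : s ≤ t) :
      Var[fun ω ↦ φ.integral W t ω - φ.integral W s ω; P] =
      ∫ x in Set.Ioc (s : ℝ) t, φ.eval x ^ 2 := by
    rw [← covariance_self (hd s t).aemeasurable, covariance_fun_sub_fun_sub (h2 _) (h2 _) (h2 _)
      (h2 _)]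
    simp only [φ.covariance_integral hW]
    rw [min_self, min_self, min_eq_right hst, min_eq_left hst, hF hst]
    ring
  have hcov : cov[fun ω ↦ φ.integral W t ω - φ.integral W s ω,
      fun ω ↦ φ.integral W t' ω - φ.integral W s' ω; P] = 0 := by
    rw [covariance_fun_sub_fun_sub (h2 _) (h2 _) (h2 _) (h2 _)]
    simp only [φ.covariance_integral hW]
    rw [min_eq_left (hts.trans hst'), min_eq_left hts, min_eq_left ((hst.trans hts).trans hst'),
      min_eq_left (hst.trans hts)]
    ring
  refine (integral_cexp_of_hasGaussianLaw (by simpa using hZ) ?_).trans ?_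
  · rw [integral_add (((hd s t).integrable one_le_two).const_mul u)
      (((hd s' t').integrable one_le_two).const_mul w), integral_const_mul, integral_const_mul,
      hzero, hzero]
    simp
  · rw [variance_fun_add ((hd s t).const_mul u) ((hd s' t').const_mul w), variance_const_mul,
      variance_const_mul, covariance_const_mul_left, covariance_const_mul_right, hcov, hvar hst,
      hvar hst']
    congr 2
    ring

/-- Since `|e^{ix} - e^{iy}| ≤ |x - y|`, convergence in `L²`, hence in `L¹`, carries over to the
exponentials. -/
lemma tendsto_integral_cexp_of_tendsto_eLpNorm [IsProbabilityMeasure P] {Z : ℕ → Ω → ℝ}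
    {Z' : Ω → ℝ} (hZ : ∀ k, AEStronglyMeasurable (Z k) P) (hZ' : AEStronglyMeasurable Z' P)
    (h : Tendsto (fun k ↦ eLpNorm (fun ω ↦ Z k ω - Z' ω) 2 P) atTop (𝓝 0)) :
    Tendsto (fun k ↦ ∫ ω, Complex.exp (Complex.I * (Z k ω : ℂ)) ∂P) atTop
      (𝓝 (∫ ω, Complex.exp (Complex.I * (Z' ω : ℂ)) ∂P)) := by
  have hm {Y : Ω → ℝ} (hY : AEStronglyMeasurable Y P) :
      AEStronglyMeasurable (fun ω ↦ Complex.exp (Complex.I * (Y ω : ℂ))) P :=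
    (by fun_prop : Continuous fun y : ℝ ↦ Complex.exp (Complex.I * (y : ℂ))
      ).comp_aestronglyMeasurable hY
  refine tendsto_integral_of_L1' _ (hm hZ') (.of_forall fun k ↦ ?_) ?_
  · refine Integrable.of_bound (hm (hZ k)) 1 (.of_forall fun ω ↦ ?_)
    rw [mul_comm, Complex.norm_exp_ofReal_mul_I]
  refine tendsto_of_tendsto_of_tendsto_of_le_of_le tendsto_const_nhds h (fun _ ↦ zero_le)
    fun k ↦ ?_
  refine le_trans (eLpNorm_mono fun ω ↦ ?_) (eLpNorm_le_eLpNorm_of_exponent_le one_le_two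
    ((hZ k).sub hZ'))
  have : Complex.exp (Complex.I * (Z k ω : ℂ)) - Complex.exp (Complex.I * (Z' ω : ℂ)) =
      Complex.exp (Z' ω * Complex.I) *
        (Complex.exp (Complex.I * ((Z k ω - Z' ω : ℝ) : ℂ)) - 1) := by
    rw [mul_sub, ← Complex.exp_add]
    push_cast
    ring_nf
  simp only [Pi.sub_apply]
  rw [this, norm_mul, Complex.norm_exp_ofReal_mul_I, one_mul]
  exact Real.norm_exp_I_mul_ofReal_sub_one_le

lemma tendsto_eLpNorm_linear_combination {α : Type*} [MeasurableSpace α] {μ : Measure α}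
    {A B : ℕ → α → ℝ} (hA : ∀ k, AEStronglyMeasurable (A k) μ)
    (hB : ∀ k, AEStronglyMeasurable (B k) μ)
    (hA' : Tendsto (fun k ↦ eLpNorm (A k) 2 μ) atTop (𝓝 0))
    (hB' : Tendsto (fun k ↦ eLpNorm (B k) 2 μ) atTop (𝓝 0)) (u w : ℝ) :
    Tendsto (fun k ↦ eLpNorm (fun x ↦ u * A k x + w * B k x) 2 μ) atTop (𝓝 0) := by
  have h1 : Tendsto (fun k ↦ ‖u‖ₑ * eLpNorm (A k) 2 μ + ‖w‖ₑ * eLpNorm (B k) 2 μ) atTop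
      (𝓝 (‖u‖ₑ * 0 + ‖w‖ₑ * 0)) :=
    (ENNReal.Tendsto.const_mul hA' (.inr enorm_ne_top)).add
      (ENNReal.Tendsto.const_mul hB' (.inr enorm_ne_top))
  simp only [mul_zero, add_zero] at h1
  refine tendsto_of_tendsto_of_tendsto_of_le_of_le tendsto_const_nhds h1 (fun _ ↦ zero_le)
    fun k ↦ ?_
  refine (eLpNorm_add_le ((hA k).const_mul u) ((hB k).const_mul w) one_le_two).trans_eq ?_
  congr 1
  · exact eLpNorm_const_smul u (A k) 2 μ
  · exact eLpNorm_const_smul w (B k) 2 μ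

lemma tendsto_integral_sq_of_tendsto_eLpNorm {α : Type*} [MeasurableSpace α] {μ : Measure α}
    {f : ℕ → α → ℝ} {g : α → ℝ} (hf : ∀ k, MemLp (f k) 2 μ) (hg : MemLp g 2 μ)
    (h : Tendsto (fun k ↦ eLpNorm (fun x ↦ f k x - g x) 2 μ) atTop (𝓝 0)) :
    Tendsto (fun k ↦ ∫ x, f k x ^ 2 ∂μ) atTop (𝓝 (∫ x, g x ^ 2 ∂μ)) := by
  have key {u : α → ℝ} (hu : MemLp u 2 μ) :
      inner ℝ (hu.toLp u) (hu.toLp u) = ∫ x, u x ^ 2 ∂μ := by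
    rw [L2.inner_def]
    refine integral_congr_ae ?_
    filter_upwards [hu.coeFn_toLp] with x hx
    rw [hx, Real.inner_apply]
    simp [sq]
  simp_rw [← key hg, ← fun k ↦ key (hf k)]
  have := (Lp.tendsto_Lp_iff_tendsto_eLpNorm'' f hf g hg).2 h
  exact this.inner this

variable {g : ℝ → ℝ} {I : ℝ≥0 → Ω → ℝ}

lemma IsWienerIntegral.exists_tendsto_increments (hI : IsWienerIntegral g W I P)
    (hW : IsPreBrownianReal W P) : ∃ φ : ℕ → StepFunction,
      (∀ t : ℝ≥0, Tendsto (fun k ↦ eLpNorm (fun u ↦ (φ k).eval u - g u) 2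
        (volume.restrict (Set.Ioc (0 : ℝ) t))) atTop (𝓝 0)) ∧
      ∀ s t, Tendsto (fun k ↦ eLpNorm (fun ω ↦ ((φ k).integral W t ω - (φ k).integral W s ω) -
        (I t ω - I s ω)) 2 P) atTop (𝓝 0) := by
  obtain ⟨φ, hφ⟩ := hI
  refine ⟨φ, fun t ↦ (hφ t).2.1, fun s t ↦ ?_⟩
  have hm (k : ℕ) (t : ℝ≥0) : AEStronglyMeasurable (fun ω ↦ (φ k).integral W t ω - I t ω) P :=
    ((φ k).integral_memLp hW t).1.sub (hφ t).1.1
  convert tendsto_eLpNorm_linear_combination (hm · t) (hm · s) (hφ t).2.2 (hφ s).2.2 1 (-1)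
    using 3 with k
  ext ω
  ring

lemma IsWienerIntegral.memLp (hI : IsWienerIntegral g W I P) (t : ℝ≥0) : MemLp (I t) 2 P := by
  obtain ⟨φ, hφ⟩ := hI
  exact (hφ t).1

/-- The limit of the formula for step functions. The joint characteristic function contains both the
law of one increment (take `w = 0`) and the independence of two (it factorizes). -/
lemma IsWienerIntegral.integral_cexp_increments (hI : IsWienerIntegral g W I P)
    (hW : IsPreBrownianReal W P)
    (hg : ∀ t : ℝ≥0, MemLp g 2 (volume.restrict (Set.Ioc (0 : ℝ) t)))
    {s t s' t' : ℝ≥0} (hst : s ≤ t) (hts : t ≤ s') (hst' : s' ≤ t') (u w : ℝ) :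
    ∫ ω, Complex.exp (Complex.I * ((u * (I t ω - I s ω) + w * (I t' ω - I s' ω) : ℝ) : ℂ)) ∂P =
      Complex.exp ((-((u ^ 2 * (∫ x in Set.Ioc (s : ℝ) t, g x ^ 2) +
        w ^ 2 * ∫ x in Set.Ioc (s' : ℝ) t', g x ^ 2) / 2) : ℝ) : ℂ) := by
  have := hW.isGaussianProcess.isProbabilityMeasure
  obtain ⟨φ, hφ, hφ'⟩ := hI.exists_tendsto_increments hW
  have hmI (s t : ℝ≥0) : AEStronglyMeasurable (fun ω ↦ I t ω - I s ω) P :=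
    (hI.memLp t).1.sub (hI.memLp s).1
  have hmφ (k : ℕ) (s t : ℝ≥0) :
      AEStronglyMeasurable (fun ω ↦ (φ k).integral W t ω - (φ k).integral W s ω) P :=
    ((φ k).integral_memLp hW t).1.sub ((φ k).integral_memLp hW s).1
  have hsq (s t : ℝ≥0) : Tendsto (fun k ↦ ∫ x in Set.Ioc (s : ℝ) t, (φ k).eval x ^ 2) atTop
      (𝓝 (∫ x in Set.Ioc (s : ℝ) t, g x ^ 2)) := by
    have hle : volume.restrict (Set.Ioc (s : ℝ) t) ≤ volume.restrict (Set.Ioc (0 : ℝ) t) :=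
      Measure.restrict_mono (Set.Ioc_subset_Ioc_left s.2) le_rfl
    exact tendsto_integral_sq_of_tendsto_eLpNorm (fun k ↦ (φ k).memLp_eval _ _)
      ((hg t).mono_measure hle)
      (tendsto_of_tendsto_of_tendsto_of_le_of_le tendsto_const_nhds (hφ t) (fun _ ↦ zero_le)
        fun k ↦ eLpNorm_mono_measure _ hle)
  have h1 := tendsto_integral_cexp_of_tendsto_eLpNorm
    (Z := fun k ω ↦ u * ((φ k).integral W t ω - (φ k).integral W s ω) +
      w * ((φ k).integral W t' ω - (φ k).integral W s' ω))
    (Z' := fun ω ↦ u * (I t ω - I s ω) + w * (I t' ω - I s' ω))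
    (fun k ↦ ((hmφ k s t).const_mul u).add ((hmφ k s' t').const_mul w))
    (((hmI s t).const_mul u).add ((hmI s' t').const_mul w)) (by
      convert tendsto_eLpNorm_linear_combination (fun k ↦ (hmφ k s t).sub (hmI s t))
        (fun k ↦ (hmφ k s' t').sub (hmI s' t')) (hφ' s t) (hφ' s' t') u w using 3 with k
      ext ω
      simp only [Pi.sub_apply]
      ring)
  simp only [fun k ↦ (φ k).integral_cexp_increments hW hst hts hst' u w] at h1
  refine tendsto_nhds_unique h1 ?_
  refine (Complex.continuous_exp.comp Complex.continuous_ofReal).continuousAt.tendsto.comp ?_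
  exact ((((hsq s t).const_mul _).add ((hsq s' t').const_mul _)).div_const 2).neg

/-- The increment of a Wiener integral is a centred Gaussian variable. -/
lemma IsWienerIntegral.hasLaw_increment (hI : IsWienerIntegral g W I P)
    (hW : IsPreBrownianReal W P)
    (hg : ∀ t : ℝ≥0, MemLp g 2 (volume.restrict (Set.Ioc (0 : ℝ) t)))
    {s t : ℝ≥0} (hst : s ≤ t) :
    HasLaw (fun ω ↦ I t ω - I s ω)
      (gaussianReal 0 (∫ x in Set.Ioc (s : ℝ) t, g x ^ 2).toNNReal) P := by
  have := hW.isGaussianProcess.isProbabilityMeasure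
  have hm : AEMeasurable (fun ω ↦ I t ω - I s ω) P :=
    ((hI.memLp t).1.sub (hI.memLp s).1).aemeasurable
  have := Measure.isProbabilityMeasure_map hm
  refine ⟨hm, Measure.ext_of_charFun ?_⟩
  ext u
  have h := hI.integral_cexp_increments hW hg hst le_rfl (le_refl t) u 0
  rw [charFun_apply_real, integral_map hm (by fun_prop), charFun_gaussianReal]
  convert h using 2
  · ext ω
    push_cast
    ring_nf
  · have : 0 ≤ ∫ x in Set.Ioc (s : ℝ) t, g x ^ 2 := integral_nonneg fun x ↦ sq_nonneg _
    rw [Real.coe_toNNReal _ this]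
    push_cast
    ring

/-- Increments of a Wiener integral over successive intervals are independent. -/
lemma IsWienerIntegral.indepFun_increments (hI : IsWienerIntegral g W I P)
    (hW : IsPreBrownianReal W P)
    (hg : ∀ t : ℝ≥0, MemLp g 2 (volume.restrict (Set.Ioc (0 : ℝ) t)))
    {s t s' t' : ℝ≥0} (hst : s ≤ t) (hts : t ≤ s') (hst' : s' ≤ t') :
    IndepFun (fun ω ↦ I t ω - I s ω) (fun ω ↦ I t' ω - I s' ω) P := by
  have := hW.isGaussianProcess.isProbabilityMeasure
  have hm (s t : ℝ≥0) : AEMeasurable (fun ω ↦ I t ω - I s ω) P :=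
    ((hI.memLp t).1.sub (hI.memLp s).1).aemeasurable
  rw [indepFun_iff_charFun_prod (hm s t) (hm s' t')]
  intro p
  have hsplit (u w : ℝ) := hI.integral_cexp_increments hW hg hst hts hst' u w
  have h1 : charFun (P.map fun ω ↦ I t ω - I s ω) p.ofLp.1 = _ :=
    congr_arg (charFun · p.ofLp.1) (hI.hasLaw_increment hW hg hst).map_eq
  have h2 : charFun (P.map fun ω ↦ I t' ω - I s' ω) p.ofLp.2 = _ :=
    congr_arg (charFun · p.ofLp.2) (hI.hasLaw_increment hW hg hst').map_eq
  rw [h1, h2, charFun_gaussianReal, charFun_gaussianReal, ← Complex.exp_add, charFun_apply,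
    integral_map (by fun_prop) (by fun_prop)]
  convert hsplit p.ofLp.1 p.ofLp.2 using 2
  · ext ω
    rw [WithLp.prod_inner_apply]
    simp only [Real.inner_apply]
    push_cast
    ring_nf
  · have h0 (s t : ℝ≥0) : 0 ≤ ∫ x in Set.Ioc (s : ℝ) t, g x ^ 2 :=
      integral_nonneg fun x ↦ sq_nonneg _
    rw [Real.coe_toNNReal _ (h0 s t), Real.coe_toNNReal _ (h0 s' t')]
    push_cast
    ring

/-- The increments of a Wiener integral are functionals of the driving process. -/
lemma IsWienerIntegral.exists_increment_eq_comp (hI : IsWienerIntegral g W I P)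
    (hW : IsPreBrownianReal W P) (s t : ℝ≥0) :
    ∃ F : (ℝ≥0 → ℝ) → ℝ, Measurable F ∧
      (fun ω ↦ I t ω - I s ω) =ᵐ[P] fun ω ↦ F (fun r ↦ W r ω) := by
  obtain ⟨φ, -, hφ⟩ := hI.exists_tendsto_increments hW
  have hmeas := tendstoInMeasure_of_tendsto_eLpNorm two_ne_zero
    (f := fun k ω ↦ (φ k).integral W t ω - (φ k).integral W s ω)
    (fun k ↦ ((φ k).integral_memLp hW t).1.sub ((φ k).integral_memLp hW s).1)
    ((hI.memLp t).1.sub (hI.memLp s).1) (hφ s t)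
  obtain ⟨ns, -, hns⟩ := hmeas.exists_seq_tendsto_ae
  let f (k : ℕ) (x : ℝ≥0 → ℝ) : ℝ :=
    (φ (ns k)).integral (fun r (x : ℝ≥0 → ℝ) ↦ x r) t x -
      (φ (ns k)).integral (fun r (x : ℝ≥0 → ℝ) ↦ x r) s x
  have hf (k : ℕ) : Measurable (f k) := by
    unfold f StepFunction.integral
    fun_prop
  -- `L²` convergence gives almost sure convergence along a subsequence; the limsup is a measurable
  -- functional of the whole path that agrees with the limit wherever the latter exists.
  refine ⟨fun x ↦ limsup (fun k ↦ f k x) atTop, Measurable.limsup hf, ?_⟩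
  filter_upwards [hns] with ω hω
  exact (Tendsto.limsup_eq hω).symm

end WienerIntegral

end JumpDiffusion

namespace JumpDiffusion

/-! ### Moments and tails of Gaussian variables -/

section GaussianMoments

lemma integral_pow_gaussianReal_zero (v : ℝ≥0) :
    ∫ x, x ^ 3 ∂gaussianReal 0 v = 0 ∧ ∫ x, x ^ 4 ∂gaussianReal 0 v = 3 * (v : ℝ) ^ 2 := by
  have hmgf : mgf id (gaussianReal 0 v) = fun t ↦ Real.exp (v * t ^ 2 / 2) := by
    rw [mgf_id_gaussianReal]
    simp
  have hint : (0 : ℝ) ∈ interior (integrableExpSet id (gaussianReal 0 v)) := by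
    simp [integrableExpSet_id_gaussianReal]
  have he (t : ℝ) : HasDerivAt (fun t ↦ Real.exp (v * t ^ 2 / 2))
      (Real.exp (v * t ^ 2 / 2) * (v * t)) t := by
    convert ((((hasDerivAt_id' t).fun_pow 2).const_mul (v : ℝ)).div_const 2).exp using 1
    push_cast
    ring
  -- Every derivative of the moment generating function `exp (v t² / 2)` is a polynomial times it;
  -- differentiation sends the polynomial `p` to `p' + p v t`. The moments are the values at `0`.
  have step (p q : ℝ → ℝ) (hp : ∀ t, HasDerivAt p (q t) t) :
      deriv (fun t ↦ p t * Real.exp (v * t ^ 2 / 2)) =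
        fun t ↦ (q t + p t * (v * t)) * Real.exp (v * t ^ 2 / 2) := by
    ext t
    rw [((hp t).fun_mul (he t)).deriv]
    ring
  have d1 : iteratedDeriv 1 (fun t : ℝ ↦ Real.exp (v * t ^ 2 / 2)) =
      fun t ↦ (v * t) * Real.exp (v * t ^ 2 / 2) := by
    rw [iteratedDeriv_one]
    ext t
    rw [(he t).deriv]
    ring
  have d2 : iteratedDeriv 2 (fun t : ℝ ↦ Real.exp (v * t ^ 2 / 2)) =
      fun t ↦ (v + v * t * (v * t)) * Real.exp (v * t ^ 2 / 2) := by
    rw [iteratedDeriv_succ, d1, step _ (fun _ ↦ (v : ℝ))]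
    exact fun t ↦ by simpa using (hasDerivAt_id t).const_mul (v : ℝ)
  have d3 : iteratedDeriv 3 (fun t : ℝ ↦ Real.exp (v * t ^ 2 / 2)) =
      fun t ↦ (2 * v ^ 2 * t + (v + v * t * (v * t)) * (v * t)) *
        Real.exp (v * t ^ 2 / 2) := by
    rw [iteratedDeriv_succ, d2, step _ (fun t ↦ 2 * (v : ℝ) ^ 2 * t)]
    intro t
    have h : HasDerivAt (fun t : ℝ ↦ v * t) (v : ℝ) t := by
      simpa using (hasDerivAt_id t).const_mul (v : ℝ)
    exact ((h.fun_mul h).const_add (v : ℝ)).congr_deriv (by ring)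
  have d4 : iteratedDeriv 4 (fun t : ℝ ↦ Real.exp (v * t ^ 2 / 2)) =
      fun t ↦ ((2 * v ^ 2 + (v + 3 * (v * t * (v * t))) * v) +
        (2 * v ^ 2 * t + (v + v * t * (v * t)) * (v * t)) * (v * t)) *
        Real.exp (v * t ^ 2 / 2) := by
    rw [iteratedDeriv_succ, d3, step _
      (fun t ↦ 2 * (v : ℝ) ^ 2 + (v + 3 * (v * t * (v * t))) * v)]
    intro t
    have h : HasDerivAt (fun t : ℝ ↦ v * t) (v : ℝ) t := by
      simpa using (hasDerivAt_id t).const_mul (v : ℝ)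
    have h' : HasDerivAt (fun t : ℝ ↦ 2 * (v : ℝ) ^ 2 * t) (2 * (v : ℝ) ^ 2) t := by
      simpa using (hasDerivAt_id t).const_mul (2 * (v : ℝ) ^ 2)
    exact (h'.fun_add (((h.fun_mul h).const_add (v : ℝ)).fun_mul h)).congr_deriv (by ring)
  have h3 := iteratedDeriv_mgf_zero hint 3
  have h4 := iteratedDeriv_mgf_zero hint 4
  rw [hmgf, d3] at h3
  rw [hmgf, d4] at h4
  simp only [Pi.pow_apply, id] at h3 h4
  refine ⟨by rw [← h3]; simp, by rw [← h4]; simp; ring⟩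

variable {Ω : Type*} [MeasurableSpace Ω] {P : Measure Ω}

lemma memLp_of_hasLaw_gaussianReal {G : Ω → ℝ} {m : ℝ} {v : ℝ≥0}
    (hG : HasLaw G (gaussianReal m v) P) (p : ℝ≥0) : MemLp G p P := by
  have h := memLp_id_gaussianReal (μ := m) (v := v) p
  rw [← hG.map_eq, memLp_map_measure_iff (by fun_prop) hG.aemeasurable] at h
  exact h

lemma integrable_pow_of_hasLaw_gaussianReal {G : Ω → ℝ} {m : ℝ} {v : ℝ≥0}
    (hG : HasLaw G (gaussianReal m v) P) (k : ℕ) : Integrable (fun ω ↦ G ω ^ k) P := by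
  have : IsProbabilityMeasure P := hG.isProbabilityMeasure
  refine (((memLp_of_hasLaw_gaussianReal hG k).integrable_norm_pow' ).mono
    (hG.aemeasurable.pow_const k).aestronglyMeasurable (.of_forall fun ω ↦ ?_))
  simp

lemma integral_sq_of_hasLaw_gaussianReal {G : Ω → ℝ} {v : ℝ≥0}
    (hG : HasLaw G (gaussianReal 0 v) P) : ∫ ω, G ω ^ 2 ∂P = v := by
  have : IsProbabilityMeasure P := hG.isProbabilityMeasure
  have h := hG.variance_eq
  rw [variance_id_gaussianReal, variance_eq_sub (memLp_of_hasLaw_gaussianReal hG 2),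
    hG.integral_eq] at h
  simpa using h

lemma integral_add_sq_of_hasLaw_gaussianReal {G : Ω → ℝ} {v : ℝ≥0}
    (hG : HasLaw G (gaussianReal 0 v) P) (g : ℝ) : ∫ ω, (g + G ω) ^ 2 ∂P = v + g ^ 2 := by
  have : IsProbabilityMeasure P := hG.isProbabilityMeasure
  have h1 : Integrable G P := by simpa using integrable_pow_of_hasLaw_gaussianReal hG 1
  have h2 := integrable_pow_of_hasLaw_gaussianReal hG 2
  simp only [add_sq]
  rw [integral_add (by fun_prop) h2, integral_add (by fun_prop) (by fun_prop),
    integral_const_mul, integral_sq_of_hasLaw_gaussianReal hG, hG.integral_eq]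
  simp
  ring

lemma integral_add_pow_four_of_hasLaw_gaussianReal {G : Ω → ℝ} {v : ℝ≥0}
    (hG : HasLaw G (gaussianReal 0 v) P) (g : ℝ) :
    ∫ ω, (g + G ω) ^ 4 ∂P = 3 * v ^ 2 + 6 * g ^ 2 * v + g ^ 4 := by
  have : IsProbabilityMeasure P := hG.isProbabilityMeasure
  have h1 : Integrable G P := by simpa using integrable_pow_of_hasLaw_gaussianReal hG 1
  have h2 := integrable_pow_of_hasLaw_gaussianReal hG 2
  have h3 := integrable_pow_of_hasLaw_gaussianReal hG 3
  have h4 := integrable_pow_of_hasLaw_gaussianReal hG 4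
  have e1 : ∫ ω, G ω ∂P = 0 := by rw [hG.integral_eq]; simp
  have e3 : ∫ ω, G ω ^ 3 ∂P = 0 :=
    (hG.integral_comp (f := fun x ↦ x ^ 3) (by fun_prop)).trans (integral_pow_gaussianReal_zero v).1
  have e4 : ∫ ω, G ω ^ 4 ∂P = 3 * v ^ 2 :=
    (hG.integral_comp (f := fun x ↦ x ^ 4) (by fun_prop)).trans (integral_pow_gaussianReal_zero v).2
  have : ∀ ω, (g + G ω) ^ 4 = g ^ 4 + 4 * g ^ 3 * G ω + 6 * g ^ 2 * G ω ^ 2 + 4 * g * G ω ^ 3 +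
      G ω ^ 4 := fun ω ↦ by ring
  simp only [this]
  rw [integral_add (by fun_prop) h4, integral_add (by fun_prop) (by fun_prop),
    integral_add (by fun_prop) (by fun_prop), integral_add (by fun_prop) (by fun_prop),
    integral_const_mul, integral_const_mul, integral_const_mul,
    integral_sq_of_hasLaw_gaussianReal hG, e1, e3, e4]
  simp
  ring

lemma variance_add_sq_of_hasLaw_gaussianReal {G : Ω → ℝ} {v : ℝ≥0}
    (hG : HasLaw G (gaussianReal 0 v) P) (g : ℝ) :
    MemLp (fun ω ↦ (g + G ω) ^ 2) 2 P ∧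
    Var[fun ω ↦ (g + G ω) ^ 2; P] = 2 * v ^ 2 + 4 * g ^ 2 * v := by
  have : IsProbabilityMeasure P := hG.isProbabilityMeasure
  have hL : HasLaw (fun ω ↦ g + G ω) (gaussianReal (0 + g) v) P := gaussianReal_const_add hG g
  have hm : MemLp (fun ω ↦ (g + G ω) ^ 2) 2 P := by
    rw [memLp_two_iff_integrable_sq (hL.aemeasurable.pow_const 2).aestronglyMeasurable]
    convert integrable_pow_of_hasLaw_gaussianReal hL 4 using 2
    ring
  refine ⟨hm, ?_⟩
  rw [variance_eq_sub hm, integral_add_sq_of_hasLaw_gaussianReal hG]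
  have : ∀ ω, ((fun ω ↦ (g + G ω) ^ 2) ^ 2) ω = (g + G ω) ^ 4 := fun ω ↦ by
    simp only [Pi.pow_apply]; ring
  simp only [this]
  rw [integral_add_pow_four_of_hasLaw_gaussianReal hG]
  ring

/-- Exponentially weighted even moments of centred Gaussian variables scale like the variance. -/
lemma exists_integral_pow_mul_exp_gaussianReal (m : ℕ) {a : ℝ} (ha : a < 1 / 2) :
    ∃ C : ℝ, 0 ≤ C ∧ ∀ v : ℝ≥0, v ≠ 0 →
      Integrable (fun x ↦ x ^ (2 * m) * Real.exp (a * (x ^ 2 / v))) (gaussianReal 0 v) ∧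
      ∫ x, x ^ (2 * m) * Real.exp (a * (x ^ 2 / v)) ∂gaussianReal 0 v = v ^ m * C := by
  -- Against the standard Gaussian density the weight leaves `exp (-(1/2 - a) x²)`, which is
  -- integrable because `a < 1/2`. General `v` follows by scaling with `√v`.
  have hint : Integrable (fun x ↦ x ^ (2 * m) * Real.exp (a * x ^ 2)) (gaussianReal 0 1) := by
    rw [gaussianReal_of_var_ne_zero 0 one_ne_zero,
      integrable_withDensity_iff_integrable_smul' (measurable_gaussianPDF 0 1)
        (.of_forall fun _ ↦ gaussianPDF_lt_top)]
    have h := (integrable_rpow_mul_exp_neg_mul_sq (b := 1 / 2 - a) (by linarith)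
      (s := ((2 * m : ℕ) : ℝ)) (by have : (0 : ℝ) ≤ ((2 * m : ℕ) : ℝ) := by positivity
                                   linarith)).const_mul (√(2 * Real.pi))⁻¹
    refine h.congr (.of_forall fun x ↦ ?_)
    simp only [toReal_gaussianPDF, gaussianPDFReal, smul_eq_mul, Real.rpow_natCast]
    rw [show -(1 / 2 - a) * x ^ 2 = -(x - 0) ^ 2 / (2 * (1 : ℝ≥0)) + a * x ^ 2 by
      push_cast; ring, Real.exp_add]
    push_cast
    ring_nf
  refine ⟨∫ x, x ^ (2 * m) * Real.exp (a * x ^ 2) ∂gaussianReal 0 1,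
    integral_nonneg fun x ↦ by rw [pow_mul]; positivity, fun v hv ↦ ?_⟩
  have hmap : gaussianReal 0 v = (gaussianReal 0 1).map (fun x ↦ √(v : ℝ) * x) := by
    rw [gaussianReal_map_const_mul]
    congr 1
    · simp
    · ext
      simp
  have hv' : (v : ℝ) ≠ 0 := by exact_mod_cast hv
  have heq (x : ℝ) : (√(v : ℝ) * x) ^ (2 * m) * Real.exp (a * ((√(v : ℝ) * x) ^ 2 / v)) =
      v ^ m * (x ^ (2 * m) * Real.exp (a * x ^ 2)) := by
    have h1 : (√(v : ℝ) * x) ^ 2 = v * x ^ 2 := by rw [mul_pow, Real.sq_sqrt v.coe_nonneg]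
    rw [pow_mul, h1, mul_div_cancel_left₀ _ hv', mul_pow, pow_mul]
    ring
  have hmeas : AEStronglyMeasurable (fun x ↦ x ^ (2 * m) * Real.exp (a * (x ^ 2 / v)))
      ((gaussianReal 0 1).map (fun x ↦ √(v : ℝ) * x)) :=
    (by fun_prop : Continuous fun x : ℝ ↦ x ^ (2 * m) * Real.exp (a * (x ^ 2 / v))
      ).aestronglyMeasurable
  rw [hmap]
  constructor
  · rw [integrable_map_measure hmeas (by fun_prop)]
    exact (hint.const_mul ((v : ℝ) ^ m)).congr (.of_forall fun x ↦ (heq x).symm)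
  · rw [integral_map (by fun_prop) hmeas]
    simp only [heq]
    rw [integral_const_mul]

/-- Tail bound for even moments of a centred Gaussian variable with variance `v`, beyond the level
`√(κ v l)`. -/
lemma exists_tail_bound_gaussianReal (m : ℕ) {a : ℝ} (ha0 : 0 ≤ a) (ha : a < 1 / 2) :
    ∃ C : ℝ, 0 ≤ C ∧ ∀ {Ω : Type*} [MeasurableSpace Ω] {P : Measure Ω} {G U : Ω → ℝ} {v : ℝ≥0}
      {K κ l : ℝ}, v ≠ 0 → HasLaw G (gaussianReal 0 v) P → 0 ≤ K →
      (∀ ω, 0 ≤ U ω) →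
      (∀ ω, U ω ≤ if κ * v * l < G ω ^ 2 then K * G ω ^ (2 * m) else 0) →
      ∫ ω, U ω ∂P ≤ K * (v ^ m * C) * Real.exp (-(a * κ * l)) := by
  obtain ⟨C, hC0, hC⟩ := exists_integral_pow_mul_exp_gaussianReal m ha
  refine ⟨C, hC0, fun {Ω} _ {P G U v K κ l} hv hG hK hU0 hU ↦ ?_⟩
  obtain ⟨hi, he⟩ := hC v hv
  have hv' : (0 : ℝ) < v := by exact_mod_cast pos_iff_ne_zero.2 hv
  have hi' : Integrable (fun ω ↦ G ω ^ (2 * m) * Real.exp (a * (G ω ^ 2 / v))) P := by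
    rw [← hG.map_eq, integrable_map_measure (by fun_prop) hG.aemeasurable] at hi
    exact hi
  rw [← he, ← hG.integral_comp (f := fun x ↦ x ^ (2 * m) * Real.exp (a * (x ^ 2 / v)))
    (by fun_prop), ← integral_const_mul, ← integral_mul_const]
  refine integral_mono_of_nonneg (.of_forall hU0) ((hi'.const_mul K).mul_const _)
    (.of_forall fun ω ↦ (hU ω).trans ?_)
  have h0 : 0 ≤ G ω ^ (2 * m) := by rw [pow_mul]; positivity
  split_ifs with h
  -- Chernoff's argument: on the event `κ v l < G²` the factor `exp (a (G² / v - κ l))` is at least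
  -- `1`.
  · simp only [Function.comp_apply]
    rw [mul_assoc, mul_assoc, ← Real.exp_add]
    refine mul_le_mul_of_nonneg_left (le_mul_of_one_le_right h0 (Real.one_le_exp ?_)) hK
    have : κ * l ≤ G ω ^ 2 / v := by
      rw [le_div_iff₀ hv']
      nlinarith
    nlinarith
  · simp only [Function.comp_apply]
    positivity

end GaussianMoments

/-! ### Small-parameter estimates for Poisson counts -/

section PoissonLaw

variable {Ω : Type*} [MeasurableSpace Ω] {P : Measure Ω}

lemma poisson_probabilities {D : Ω → ℝ} {L : ℝ≥0}
    (hD : HasLaw D ((poissonMeasure L).map (Nat.cast : ℕ → ℝ)) P) :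
    P.real {ω | D ω = 0} = Real.exp (-L) ∧ P.real {ω | D ω = 1} = Real.exp (-L) * L := by
  have key (k : ℕ) : P.real {ω | D ω = k} = Real.exp (-L) * L ^ k / k.factorial := by
    have hs : MeasurableSet {x : ℝ | x = k} := by simp
    rw [hD.measureReal_eq (p := fun x ↦ x = k) hs, map_measureReal_apply .of_discrete hs,
      ← poissonMeasure_real_singleton]
    congr 1
    ext j
    simp
  refine ⟨by simpa using key 0, by simpa using key 1⟩

lemma measure_ne_zero_one_le {D : Ω → ℝ} {L : ℝ≥0}
    (hD : HasLaw D ((poissonMeasure L).map (Nat.cast : ℕ → ℝ)) P) :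
    P.real {ω | D ω ≠ 0 ∧ D ω ≠ 1} ≤ (L : ℝ) ^ 2 := by
  have : IsProbabilityMeasure ((poissonMeasure L).map (Nat.cast : ℕ → ℝ)) :=
    Measure.isProbabilityMeasure_map .of_discrete
  have : IsProbabilityMeasure P := hD.isProbabilityMeasure
  obtain ⟨h0, h1⟩ := poisson_probabilities hD
  have hm (x : ℝ) : NullMeasurableSet {ω | D ω = x} P :=
    hD.aemeasurable.nullMeasurableSet_preimage (measurableSet_singleton x)
  have hdisj : Disjoint {ω | D ω = 0} {ω | D ω = 1} := by
    rw [Set.disjoint_left]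
    intro ω h h'
    simp only [Set.mem_ofPred_eq] at h h'
    linarith
  have hc : {ω | D ω ≠ 0 ∧ D ω ≠ 1} = ({ω | D ω = 0} ∪ {ω | D ω = 1})ᶜ := by
    ext ω
    simp
  rw [hc, probReal_compl_eq_one_sub₀ ((hm 0).union (hm 1)),
    measureReal_union₀ (hm 1) hdisj.aedisjoint, h0, h1]
  have hL : (0 : ℝ) ≤ L := L.2
  -- The probability is `1 - e^{-L} (1 + L)`, and `e^{-L} ≥ 1 - L` bounds it by `1 - (1 - L)(1 + L)
  -- = L²`.
  have := Real.add_one_le_exp (-(L : ℝ))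
  nlinarith

lemma memLp_of_hasLaw_poisson {D : Ω → ℝ} {L : ℝ≥0}
    (hD : HasLaw D ((poissonMeasure L).map (Nat.cast : ℕ → ℝ)) P) : MemLp D 2 P := by
  have : Integrable (fun n : ℕ ↦ (n : ℝ) ^ 2) (poissonMeasure L) := by
    rw [integrable_poissonMeasure_iff]
    have h := (Real.summable_pow_div_factorial (2 * L)).mul_left (Real.exp (-L) * 2)
    refine h.of_nonneg_of_le (fun n ↦ by positivity) fun n ↦ ?_
    -- This bounds the series of the second moment by a multiple of the exponential series at `2L`.
    have h2 : (n : ℝ) ^ 2 ≤ 2 * 2 ^ n := by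
      have hnat : n ^ 2 ≤ 2 * 2 ^ n := by
        induction n with
        | zero => simp
        | succ k ih =>
          rcases Nat.lt_or_ge k 3 with hk | hk
          · interval_cases k <;> simp
          · rw [pow_succ 2]
            nlinarith
      exact_mod_cast hnat
    rw [Real.norm_of_nonneg (by positivity)]
    calc Real.exp (-L) * (L : ℝ) ^ n / n.factorial * (n : ℝ) ^ 2
        ≤ Real.exp (-L) * (L : ℝ) ^ n / n.factorial * (2 * 2 ^ n) := by gcongr
      _ = _ := by rw [mul_pow]; ring
  rw [memLp_two_iff_integrable_sq hD.aemeasurable.aestronglyMeasurable]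
  have h2 : Integrable (fun x : ℝ ↦ x ^ 2) ((poissonMeasure L).map (Nat.cast : ℕ → ℝ)) := by
    rw [integrable_map_measure (by fun_prop) .of_discrete]
    exact this
  rw [← hD.map_eq, integrable_map_measure (by fun_prop) hD.aemeasurable] at h2
  exact h2

end PoissonLaw

end JumpDiffusion

/-! ### Truncated squares and the mean over one cell -/

namespace JumpDiffusion

/-- `x² 1_{|x| ≤ B}`. -/
noncomputable def truncSq (B x : ℝ) : ℝ := if |x| ≤ B then x ^ 2 else 0

lemma truncSq_nonneg (B x : ℝ) : 0 ≤ truncSq B x := by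
  unfold truncSq
  split_ifs <;> positivity

lemma truncSq_le_sq (B x : ℝ) : truncSq B x ≤ x ^ 2 := by
  unfold truncSq
  split_ifs
  · exact le_rfl
  · positivity

lemma truncSq_le (B x : ℝ) : truncSq B x ≤ B ^ 2 := by
  unfold truncSq
  split_ifs with h
  · exact sq_le_sq' (by linarith [neg_abs_le x]) (le_trans (le_abs_self x) h)
  · positivity

lemma truncSq_le_indicator (B x : ℝ) : truncSq B x ≤ if |x| ≤ B then B ^ 2 else 0 := by
  by_cases h : |x| ≤ B
  · rw [if_pos h]
    exact truncSq_le B x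
  · simp [truncSq, h]

lemma measurable_truncSq (B : ℝ) : Measurable (truncSq B) := by
  unfold truncSq
  exact Measurable.ite (measurableSet_le measurable_norm measurable_const) (by fun_prop)
    measurable_const

section Increment

variable {Ω : Type*} [MeasurableSpace Ω] {P : Measure Ω}

/-- Condition on `G = x` by Fubini: `V` and `ζ` are independent, and the bound on the probability
that `ζ` lies near `-x` is uniform in `x`. -/
lemma measure_inter_abs_add_le [IsProbabilityMeasure P] {E : Type*} [MeasurableSpace E]
    {G ζ : Ω → ℝ} {V : Ω → E} (hG : IndepFun G (fun ω ↦ (V ω, ζ ω)) P) (hV : IndepFun V ζ P)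
    (mG : AEMeasurable G P) (mV : Measurable V) (mζ : Measurable ζ) {S : Set E}
    (hS : MeasurableSet S) {B : ℝ} {c : ℝ≥0∞} (hc : ∀ x, P {ω | |x + ζ ω| ≤ B} ≤ c) :
    P {ω | V ω ∈ S ∧ |G ω + ζ ω| ≤ B} ≤ P {ω | V ω ∈ S} * c := by
  have mT : MeasurableSet {q : ℝ × E × ℝ | q.2.1 ∈ S ∧ |q.1 + q.2.2| ≤ B} :=
    (hS.preimage (measurable_fst.comp measurable_snd : Measurable fun q : ℝ × E × ℝ ↦ q.2.1)).inter
      (measurableSet_le (f := fun q : ℝ × E × ℝ ↦ |q.1 + q.2.2|) (by fun_prop) measurable_const)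
  have mVζ : Measurable fun ω ↦ (V ω, ζ ω) := by fun_prop
  have hmap := (indepFun_iff_map_prod_eq_prod_map_map mG mVζ.aemeasurable).1 hG
  have := Measure.isProbabilityMeasure_map mG
  calc P {ω | V ω ∈ S ∧ |G ω + ζ ω| ≤ B}
      = (P.map fun ω ↦ (G ω, V ω, ζ ω)) {q | q.2.1 ∈ S ∧ |q.1 + q.2.2| ≤ B} := by
        rw [Measure.map_apply_of_aemeasurable (mG.prodMk mVζ.aemeasurable) mT]
        rfl
    _ = ∫⁻ x, P {ω | V ω ∈ S ∧ |x + ζ ω| ≤ B} ∂P.map G := by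
        rw [hmap, Measure.prod_apply mT]
        refine lintegral_congr fun x ↦ ?_
        rw [Measure.map_apply mVζ (measurable_prodMk_left mT)]
        rfl
    _ ≤ ∫⁻ _, P {ω | V ω ∈ S} * c ∂P.map G := by
        refine lintegral_mono fun x ↦ ?_
        have mA : MeasurableSet {z : ℝ | |x + z| ≤ B} :=
          measurableSet_le (by fun_prop) measurable_const
        exact (hV.measure_inter_preimage_eq_mul S _ hS mA).trans_le
          (mul_le_mul_right (hc x) _)
    _ = P {ω | V ω ∈ S} * c := by simp

lemma measure_abs_add_le_of_density {ζ : Ω → ℝ} {f : ℝ → ℝ} {M : ℝ} (hf : ∀ x, f x ≤ M)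
    (hM : 0 ≤ M) (hζ : HasLaw ζ (volume.withDensity fun x ↦ ENNReal.ofReal (f x)) P) (B x : ℝ) :
    P {ω | |x + ζ ω| ≤ B} ≤ ENNReal.ofReal (2 * B * M) := by
  have mA : MeasurableSet {z : ℝ | |x + z| ≤ B} :=
    measurableSet_le (by fun_prop) measurable_const
  rw [hζ.measure_eq (p := fun z ↦ |x + z| ≤ B) mA, withDensity_apply _ mA]
  calc ∫⁻ z in {z : ℝ | |x + z| ≤ B}, ENNReal.ofReal (f z)
      ≤ ∫⁻ _ in {z : ℝ | |x + z| ≤ B}, ENNReal.ofReal M :=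
        lintegral_mono fun z ↦ ENNReal.ofReal_le_ofReal (hf z)
    _ = ENNReal.ofReal M * volume (Set.Icc (-B - x) (B - x)) := by
        rw [setLIntegral_const]
        congr 2
        ext z
        simp only [Set.mem_ofPred_eq, abs_le, Set.mem_Icc]
        constructor <;> rintro ⟨h1, h2⟩ <;> constructor <;> linarith
    _ = ENNReal.ofReal (2 * B * M) := by
        rw [Real.volume_Icc, ← ENNReal.ofReal_mul hM]
        congr 1
        ring

/-- `Δ = g + G + ∑_{ns ≤ j < nt} ζ_j` with a centred Gaussian variable `G` of variance `v`, a Poisson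
variable `nt - ns` of parameter `L`, and jumps `ζ_j` with densities bounded by `M`. -/
structure IsJumpIncrement (P : Measure Ω) (G : Ω → ℝ) (ns nt : Ω → ℕ) (ζ : ℕ → Ω → ℝ) (g : ℝ)
    (v L : ℝ≥0) (M : ℝ) (Δ : Ω → ℝ) : Prop where
  law_gauss : HasLaw G (gaussianReal 0 v) P
  measurable_left : Measurable ns
  measurable_right : Measurable nt
  measurable_jump : ∀ j, Measurable (ζ j)
  indep_gauss : IndepFun G (fun ω ↦ ((ns ω, nt ω), fun j ↦ ζ j ω)) P
  indep_jump : IndepFun (fun ω ↦ (ns ω, nt ω)) (fun ω j ↦ ζ j ω) P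
  law_count : HasLaw (fun ω ↦ (nt ω : ℝ) - ns ω) ((poissonMeasure L).map (Nat.cast : ℕ → ℝ)) P
  bound_nonneg : 0 ≤ M
  small_ball : ∀ j x B, P {ω | |x + ζ j ω| ≤ B} ≤ ENNReal.ofReal (2 * B * M)
  eq : Δ =ᵐ[P] fun ω ↦ g + G ω +
    (∑ j ∈ Finset.range (nt ω), ζ j ω - ∑ j ∈ Finset.range (ns ω), ζ j ω)

namespace IsJumpIncrement

variable {G : Ω → ℝ} {ns nt : Ω → ℕ} {ζ : ℕ → Ω → ℝ} {g : ℝ} {v L : ℝ≥0} {M : ℝ} {Δ : Ω → ℝ}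

/-- The single jump is `ζ_{ns}`, with a random index. Splitting according to the value `k` of `ns`
makes the index deterministic; each piece gains the factor `2BM`, and the disjoint pieces add up to
the event of exactly one jump. -/
lemma measure_one_jump_le [IsProbabilityMeasure P] (h : IsJumpIncrement P G ns nt ζ g v L M Δ)
    {B : ℝ} (hB : 0 ≤ B) :
    P.real {ω | nt ω = ns ω + 1 ∧ |Δ ω| ≤ B} ≤ 2 * B * M * L := by
  have mns := h.measurable_left
  have mnt := h.measurable_right
  have mV : Measurable fun ω ↦ (ns ω, nt ω) := mns.prodMk mnt
  have mone : MeasurableSet {ω | nt ω = ns ω + 1} := measurableSet_eq_fun mnt (mns.add_const 1)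
  have step (k : ℕ) : P {ω | (ns ω, nt ω) ∈ ({(k, k + 1)} : Set (ℕ × ℕ)) ∧
      |(g + G ω) + ζ k ω| ≤ B} ≤
        P {ω | (ns ω, nt ω) ∈ ({(k, k + 1)} : Set (ℕ × ℕ))} * ENNReal.ofReal (2 * B * M) := by
    refine measure_inter_abs_add_le ?_ ?_ (h.law_gauss.aemeasurable.const_add g) mV
      (h.measurable_jump k) (measurableSet_singleton _) fun x ↦ h.small_ball k x B
    · exact h.indep_gauss.comp (φ := fun x ↦ g + x)
        (ψ := fun q : (ℕ × ℕ) × (ℕ → ℝ) ↦ (q.1, q.2 k)) (by fun_prop) (by fun_prop)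
    · exact h.indep_jump.comp (φ := id) (ψ := fun q : ℕ → ℝ ↦ q k) (by fun_prop) (by fun_prop)
  have hsub : ∀ᵐ ω ∂P, ω ∈ {ω | nt ω = ns ω + 1 ∧ |Δ ω| ≤ B} →
      ω ∈ ⋃ k, {ω | (ns ω, nt ω) ∈ ({(k, k + 1)} : Set (ℕ × ℕ)) ∧ |(g + G ω) + ζ k ω| ≤ B} := by
    filter_upwards [h.eq] with ω hω ⟨h1, h2⟩
    refine Set.mem_iUnion.2 ⟨ns ω, by simp [h1], ?_⟩
    rw [hω, h1, Finset.sum_range_succ, add_sub_cancel_left] at h2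
    exact h2
  have hle : P {ω | nt ω = ns ω + 1 ∧ |Δ ω| ≤ B} ≤
      P {ω | nt ω = ns ω + 1} * ENNReal.ofReal (2 * B * M) := by
    refine (measure_mono_ae hsub).trans ((measure_iUnion_le _).trans
      ((ENNReal.tsum_le_tsum step).trans_eq ?_))
    rw [ENNReal.tsum_mul_right, ← measure_iUnion]
    · congr 2
      ext ω
      simp only [Set.mem_singleton_iff, Prod.mk.injEq, Set.mem_iUnion, Set.mem_ofPred_eq]
      constructor
      · rintro ⟨k, h1, h2⟩
        omega
      · intro h1
        exact ⟨ns ω, rfl, h1⟩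
    · intro i j hij
      rw [Function.onFun, Set.disjoint_left]
      intro ω h1 h2
      simp only [Set.mem_singleton_iff, Prod.mk.injEq, Set.mem_ofPred_eq] at h1 h2
      exact hij (h1.1.symm.trans h2.1)
    · exact fun k ↦ mV (measurableSet_singleton _)
  have hone : P.real {ω | nt ω = ns ω + 1} ≤ L := by
    have h1 := (poisson_probabilities h.law_count).2
    have : {ω | (nt ω : ℝ) - ns ω = 1} = {ω | nt ω = ns ω + 1} := by
      ext ω
      simp only [Set.mem_ofPred_eq, sub_eq_iff_eq_add]
      rw [add_comm]
      exact_mod_cast Iff.rfl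
    rw [this] at h1
    rw [h1]
    exact mul_le_of_le_one_left L.2 (Real.exp_le_one_iff.2 (by simp))
  have h0 : 0 ≤ 2 * B * M := by have := h.bound_nonneg; positivity
  calc P.real {ω | nt ω = ns ω + 1 ∧ |Δ ω| ≤ B}
      ≤ (P {ω | nt ω = ns ω + 1} * ENNReal.ofReal (2 * B * M)).toReal :=
        ENNReal.toReal_mono (ENNReal.mul_ne_top (measure_ne_top _ _) ENNReal.ofReal_ne_top) hle
    _ = P.real {ω | nt ω = ns ω + 1} * (2 * B * M) := by
        rw [ENNReal.toReal_mul, ENNReal.toReal_ofReal h0]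
        rfl
    _ ≤ 2 * B * M * L := by rw [mul_comm]; gcongr

lemma aemeasurable (h : IsJumpIncrement P G ns nt ζ g v L M Δ) : AEMeasurable Δ P := by
  have hsum (n : Ω → ℕ) (hn : Measurable n) :
      Measurable fun ω ↦ ∑ j ∈ Finset.range (n ω), ζ j ω := by
    have : Measurable fun p : ℕ × Ω ↦ ∑ j ∈ Finset.range p.1, ζ j p.2 :=
      measurable_from_prod_countable_right fun n ↦
        Finset.measurable_sum (Finset.range n) fun j _ ↦ h.measurable_jump j
    exact this.comp (hn.prodMk measurable_id)
  exact ((h.law_gauss.aemeasurable.const_add g).add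
    ((hsum nt h.measurable_right).sub (hsum ns h.measurable_left)).aemeasurable).congr h.eq.symm

lemma truncSq_eq_of_no_jump (h : IsJumpIncrement P G ns nt ζ g v L M Δ) :
    ∀ᵐ ω ∂P, nt ω = ns ω → Δ ω = g + G ω := by
  filter_upwards [h.eq] with ω hω h1
  rw [hω, h1, sub_self, add_zero]

lemma abs_truncSq_sub_le (h : IsJumpIncrement P G ns nt ζ g v L M Δ) (B : ℝ) :
    ∀ᵐ ω ∂P, |truncSq B (Δ ω) - truncSq B (g + G ω)| ≤
      B ^ 2 * if nt ω = ns ω then 0 else 1 := by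
  filter_upwards [h.truncSq_eq_of_no_jump] with ω hω
  split_ifs with h1
  · simp [hω h1]
  · rw [mul_one, abs_le]
    constructor <;> linarith [truncSq_nonneg B (Δ ω), truncSq_nonneg B (g + G ω),
      truncSq_le B (Δ ω), truncSq_le B (g + G ω)]

lemma integrable_truncSq [IsProbabilityMeasure P] {Y : Ω → ℝ} (hY : AEMeasurable Y P) (B : ℝ) :
    Integrable (fun ω ↦ truncSq B (Y ω)) P := by
  refine Integrable.of_bound ((measurable_truncSq B).comp_aemeasurable hY).aestronglyMeasurable
    (B ^ 2) (.of_forall fun ω ↦ ?_)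
  rw [Real.norm_of_nonneg (truncSq_nonneg _ _)]
  exact truncSq_le _ _

/-- The mean of the truncated square of a jump increment, up to negligible terms. -/
lemma abs_integral_truncSq_sub_le [IsProbabilityMeasure P]
    (h : IsJumpIncrement P G ns nt ζ g v L M Δ) {B : ℝ} (hB : 0 ≤ B) :
    |∫ ω, truncSq B (Δ ω) ∂P - (v + g ^ 2 - L * v)| ≤
      ∫ ω, ((g + G ω) ^ 2 - truncSq B (g + G ω)) ∂P + v * L ^ 2 + g ^ 2 * L +
        B ^ 2 * (2 * B * M * L + L ^ 2) := by
  have mns := h.measurable_left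
  have mnt := h.measurable_right
  have mG : AEMeasurable (fun ω ↦ g + G ω) P := h.law_gauss.aemeasurable.const_add g
  have m0 : MeasurableSet {ω | nt ω = ns ω} := measurableSet_eq_fun mnt mns
  have hi1 := integrable_truncSq h.aemeasurable B
  have hi2 := integrable_truncSq mG B
  have hL : (0 : ℝ) ≤ L := L.2
  have hM := h.bound_nonneg
  -- the mean without jumps
  have e1 : ∫ ω in {ω | nt ω = ns ω}, truncSq B (Δ ω) ∂P =
      (∫ ω, truncSq B (g + G ω) ∂P) * Real.exp (-L) := by
    have h1 : ∫ ω in {ω | nt ω = ns ω}, truncSq B (Δ ω) ∂P =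
        ∫ ω, truncSq B (g + G ω) * (if nt ω = ns ω then 1 else 0) ∂P := by
      rw [← integral_indicator m0]
      refine integral_congr_ae ?_
      filter_upwards [h.truncSq_eq_of_no_jump] with ω hω
      by_cases h1 : nt ω = ns ω
      · simp [Set.indicator, h1, hω h1]
      · simp [Set.indicator, h1]
    have hind : IndepFun (fun ω ↦ truncSq B (g + G ω))
        (fun ω ↦ if nt ω = ns ω then (1 : ℝ) else 0) P :=
      h.indep_gauss.comp (φ := fun x ↦ truncSq B (g + x))
        (ψ := fun q : (ℕ × ℕ) × (ℕ → ℝ) ↦ if q.1.2 = q.1.1 then (1 : ℝ) else 0)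
        ((measurable_truncSq B).comp (by fun_prop))
        (Measurable.ite (measurableSet_eq_fun (by fun_prop) (by fun_prop)) measurable_const
          measurable_const)
    rw [h1, hind.integral_fun_mul_eq_mul_integral hi2.1
      (Measurable.ite m0 measurable_const measurable_const).aestronglyMeasurable]
    congr 1
    have h2 : (fun ω ↦ if nt ω = ns ω then (1 : ℝ) else 0) =
        Set.indicator {ω | nt ω = ns ω} 1 := by
      ext ω
      simp [Set.indicator]
    rw [h2, integral_indicator_one m0, ← (poisson_probabilities h.law_count).1]
    congr 1
    ext ω
    simp [sub_eq_zero]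
  -- the contribution of the jumps
  have e2 : ∫ ω in {ω | nt ω = ns ω}ᶜ, truncSq B (Δ ω) ∂P ≤
      B ^ 2 * (2 * B * M * L + L ^ 2) := by
    have mone : NullMeasurableSet {ω | nt ω = ns ω + 1 ∧ |Δ ω| ≤ B} P :=
      (measurableSet_eq_fun mnt (mns.add_const 1)).nullMeasurableSet.inter
        (h.aemeasurable.nullMeasurableSet_preimage
          (measurableSet_le measurable_norm measurable_const : MeasurableSet {x : ℝ | ‖x‖ ≤ B}))
    have mtwo : MeasurableSet {ω | (nt ω : ℝ) - ns ω ≠ 0 ∧ (nt ω : ℝ) - ns ω ≠ 1} := by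
      have hmD : Measurable fun ω ↦ (nt ω : ℝ) - ns ω := by fun_prop
      exact (hmD (measurableSet_singleton 0).compl).inter (hmD (measurableSet_singleton 1).compl)
    have hb := measure_ne_zero_one_le h.law_count
    have ha := h.measure_one_jump_le hB
    rw [← integral_indicator m0.compl]
    -- With one jump the truncated square vanishes unless `|Δ| ≤ B`; for any other nonzero count the
    -- crude bound `B²` suffices, as the probability is already `O(L²)`.
    calc ∫ ω, Set.indicator {ω | nt ω = ns ω}ᶜ (fun ω ↦ truncSq B (Δ ω)) ω ∂P
        ≤ ∫ ω, (Set.indicator {ω | nt ω = ns ω + 1 ∧ |Δ ω| ≤ B} (fun _ ↦ B ^ 2) ω +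
          Set.indicator {ω | (nt ω : ℝ) - ns ω ≠ 0 ∧ (nt ω : ℝ) - ns ω ≠ 1}
            (fun _ ↦ B ^ 2) ω) ∂P := by
          refine integral_mono (hi1.indicator m0.compl)
            (((integrable_const _).indicator₀ mone).add ((integrable_const _).indicator mtwo))
            fun ω ↦ ?_
          have hB2 : 0 ≤ B ^ 2 := sq_nonneg B
          have hle := truncSq_le_indicator B (Δ ω)
          have hle' := truncSq_le B (Δ ω)
          by_cases h0 : nt ω = ns ω
          · simp only [Set.indicator, Set.mem_compl_iff, Set.mem_ofPred_eq, h0, not_true, if_false]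
            positivity
          by_cases h1 : nt ω = ns ω + 1
          · have h2 : (nt ω : ℝ) - ns ω = 1 := by rw [h1]; push_cast; ring
            have i1 : ω ∉ {ω | (nt ω : ℝ) - ns ω ≠ 0 ∧ (nt ω : ℝ) - ns ω ≠ 1} := fun h ↦ h.2 h2
            have i2 : ω ∈ {ω | nt ω = ns ω}ᶜ := h0
            rw [Set.indicator_of_mem i2, Set.indicator_of_notMem i1, add_zero]
            refine hle.trans_eq ?_
            simp [Set.indicator, h1]
          · have h2 : (nt ω : ℝ) - ns ω ≠ 1 := by
              rw [ne_eq, sub_eq_iff_eq_add, add_comm]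
              exact_mod_cast h1
            have h3 : (nt ω : ℝ) - ns ω ≠ 0 := by
              rw [ne_eq, sub_eq_zero]
              exact_mod_cast h0
            simp only [Set.indicator, Set.mem_compl_iff, Set.mem_ofPred_eq, h0, h1, h2, h3,
              ne_eq, not_false_eq_true, and_self, if_true, false_and, if_false, zero_add]
            exact hle'
      _ = B ^ 2 * (P.real {ω | nt ω = ns ω + 1 ∧ |Δ ω| ≤ B} +
          P.real {ω | (nt ω : ℝ) - ns ω ≠ 0 ∧ (nt ω : ℝ) - ns ω ≠ 1}) := by
          rw [integral_add ((integrable_const _).indicator₀ mone)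
            ((integrable_const _).indicator mtwo), integral_indicator₀ mone,
            integral_indicator mtwo, setIntegral_const, setIntegral_const, smul_eq_mul,
            smul_eq_mul]
          ring
      _ ≤ B ^ 2 * (2 * B * M * L + L ^ 2) := by gcongr
  have e2' : 0 ≤ ∫ ω in {ω | nt ω = ns ω}ᶜ, truncSq B (Δ ω) ∂P :=
    integral_nonneg fun ω ↦ truncSq_nonneg _ _
  have e3 : ∫ ω, truncSq B (g + G ω) ∂P =
      v + g ^ 2 - ∫ ω, ((g + G ω) ^ 2 - truncSq B (g + G ω)) ∂P := by
    rw [integral_sub ((variance_add_sq_of_hasLaw_gaussianReal h.law_gauss g).1.integrable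
      one_le_two) hi2, integral_add_sq_of_hasLaw_gaussianReal h.law_gauss]
    ring
  have e4 : 0 ≤ ∫ ω, ((g + G ω) ^ 2 - truncSq B (g + G ω)) ∂P :=
    integral_nonneg fun ω ↦ sub_nonneg.2 (truncSq_le_sq _ _)
  rw [← integral_add_compl m0 hi1, e1, e3]
  set EU := ∫ ω, ((g + G ω) ^ 2 - truncSq B (g + G ω)) ∂P
  set J := ∫ ω in {ω | nt ω = ns ω}ᶜ, truncSq B (Δ ω) ∂P
  have x1 : Real.exp (-L) ≤ 1 := Real.exp_le_one_iff.2 (by linarith)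
  have x2 : 1 - L ≤ Real.exp (-L) := by linarith [Real.add_one_le_exp (-(L : ℝ))]
  -- From `e^{-L} ≤ 1 / (1 + L)` and `(1 - L + L²)(1 + L) = 1 + L³ ≥ 1`.
  have x3 : Real.exp (-L) ≤ 1 - L + L ^ 2 := by
    have h1 : Real.exp (-L) * (1 + L) ≤ 1 := by
      calc Real.exp (-L) * (1 + L) ≤ Real.exp (-L) * Real.exp L := by
            gcongr; linarith [Real.add_one_le_exp (L : ℝ)]
        _ = 1 := by rw [← Real.exp_add]; simp
    have h2 : (1 : ℝ) ≤ (1 - L + L ^ 2) * (1 + L) := by nlinarith [pow_nonneg hL 3]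
    exact le_of_mul_le_mul_right (h1.trans h2) (by linarith)
  have hv : (0 : ℝ) ≤ v := v.2
  have hx0 := (Real.exp_pos (-(L : ℝ))).le
  set x := Real.exp (-(L : ℝ))
  -- The quantity to bound equals `v (x - 1 + L) - g² (1 - x) - EU x + J`; each of the four terms is
  -- estimated separately.
  have y1 : 0 ≤ v * (x - 1 + L) := mul_nonneg hv (by linarith)
  have y2 : v * (x - 1 + L) ≤ v * L ^ 2 := mul_le_mul_of_nonneg_left (by linarith) hv
  have y3 : 0 ≤ g ^ 2 * (1 - x) := mul_nonneg (sq_nonneg g) (by linarith)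
  have y4 : g ^ 2 * (1 - x) ≤ g ^ 2 * L := mul_le_mul_of_nonneg_left (by linarith) (sq_nonneg g)
  have y5 : 0 ≤ EU * x := mul_nonneg e4 hx0
  have y6 : EU * x ≤ EU := mul_le_of_le_one_right e4 x1
  have y7 : 0 ≤ v * (L : ℝ) ^ 2 := by positivity
  have y8 : 0 ≤ g ^ 2 * (L : ℝ) := by positivity
  rw [abs_le]
  constructor <;> nlinarith

end IsJumpIncrement

end Increment

end JumpDiffusion

namespace JumpDiffusion

/-! ### Riemann sums of products of cell averages -/

section RiemannSums

/-- The cells are open on the left, so the index is a ceiling minus one; the natural subtraction is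
not truncated because `x > 0`. -/
lemma mem_cell_of_mem_Ioc {T x : ℝ} (hT : 0 < T) {n : ℕ} (hn : 0 < n) (hx : x ∈ Set.Ioc 0 T) :
    ⌈x / (T / n)⌉₊ - 1 < n ∧ x ∈ Set.Ioc (((⌈x / (T / n)⌉₊ - 1 : ℕ) : ℝ) * (T / n))
      (((⌈x / (T / n)⌉₊ - 1 + 1 : ℕ) : ℝ) * (T / n)) := by
  have hn' : (0 : ℝ) < n := by exact_mod_cast hn
  have hh : 0 < T / n := by positivity
  have hpos : 0 < ⌈x / (T / n)⌉₊ := Nat.ceil_pos.2 (div_pos hx.1 hh)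
  have hle : ⌈x / (T / n)⌉₊ ≤ n := by
    rw [Nat.ceil_le, div_le_iff₀ hh]
    calc x ≤ T := hx.2
      _ = n * (T / n) := by field_simp
  refine ⟨by omega, ?_, ?_⟩
  · rw [← lt_div_iff₀ hh]
    exact Nat.lt_ceil.1 (by omega)
  · rw [Nat.sub_add_cancel hpos, ← div_le_iff₀ hh]
    exact Nat.le_ceil _

lemma ceil_div_sub_one_eq {h x : ℝ} (hh : 0 < h) {i : ℕ}
    (hx : x ∈ Set.Ioc ((i : ℝ) * h) (((i + 1 : ℕ) : ℝ) * h)) : ⌈x / h⌉₊ - 1 = i := by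
  have : ⌈x / h⌉₊ = i + 1 := by
    rw [Nat.ceil_eq_iff (by omega)]
    exact ⟨by rw [lt_div_iff₀ hh]; simpa using hx.1, by rw [div_le_iff₀ hh]; exact hx.2⟩
  omega

/-- Riemann sums of products of cell averages converge to the integral of the product. -/
lemma tendsto_sum_integral_mul_integral {f g : ℝ → ℝ} {T M : ℝ} (hT : 0 < T)
    (hf : AEStronglyMeasurable f (volume.restrict (Set.Ioc 0 T)))
    (hg : AEStronglyMeasurable g (volume.restrict (Set.Ioc 0 T)))
    (hfM : ∀ x ∈ Set.Ioc 0 T, |f x| ≤ M) (hgM : ∀ x ∈ Set.Ioc 0 T, |g x| ≤ M) :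
    Tendsto (fun n : ℕ ↦ (∑ i ∈ Finset.range n,
      (∫ x in (i * (T / n))..((i + 1 : ℕ) * (T / n)), f x) *
        ∫ x in (i * (T / n))..((i + 1 : ℕ) * (T / n)), g x) / (T / n)) atTop
      (𝓝 (∫ x in (0 : ℝ)..T, f x * g x)) := by
  have hM : 0 ≤ M := (abs_nonneg _).trans (hfM T ⟨hT, le_rfl⟩)
  let c (n k : ℕ) : ℝ := (∫ x in (k * (T / n))..((k + 1 : ℕ) * (T / n)), g x) / (T / n)
  -- `A n` replaces `g` by its average over the cell of `x`. The sum then equals `∫ f · A n`, and `A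
  -- n → g` almost everywhere under a uniform bound.
  let A (n : ℕ) (x : ℝ) : ℝ := c n (⌈x / (T / n)⌉₊ - 1)
  have hA (n : ℕ) : Measurable (A n) :=
    (measurable_of_countable (c n)).comp
      ((measurable_of_countable (fun k : ℕ ↦ k - 1)).comp
        (Nat.measurable_ceil.comp (by fun_prop)))
  have hcell {n : ℕ} (hn : 0 < n) {k : ℕ} (hk : k < n) :
      Set.Ioc ((k : ℝ) * (T / n)) ((k + 1 : ℕ) * (T / n)) ⊆ Set.Ioc 0 T := by
    have hn' : (0 : ℝ) < n := by exact_mod_cast hn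
    refine Set.Ioc_subset_Ioc (by positivity) ?_
    have h1 : ((k + 1 : ℕ) : ℝ) ≤ n := by exact_mod_cast hk
    calc ((k + 1 : ℕ) : ℝ) * (T / n) ≤ n * (T / n) := by gcongr
      _ = T := by field_simp
  have hcM {n : ℕ} (hn : 0 < n) {k : ℕ} (hk : k < n) : |c n k| ≤ M := by
    have hn' : (0 : ℝ) < n := by exact_mod_cast hn
    have hh : 0 < T / n := by positivity
    have hle : (k : ℝ) * (T / n) ≤ (k + 1 : ℕ) * (T / n) := by push_cast; nlinarith
    have h1 := intervalIntegral.norm_integral_le_of_norm_le_const (f := g) (C := M)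
      (a := k * (T / n)) (b := (k + 1 : ℕ) * (T / n)) (fun x hx ↦
        hgM x (hcell hn hk (by rwa [Set.uIoc_of_le hle] at hx)))
    rw [abs_div, abs_of_pos hh, div_le_iff₀ hh]
    refine h1.trans_eq ?_
    rw [abs_of_nonneg (by linarith)]
    push_cast
    ring
  have hAM {n : ℕ} (hn : 0 < n) {x : ℝ} (hx : x ∈ Set.Ioc 0 T) : |A n x| ≤ M :=
    hcM hn (mem_cell_of_mem_Ioc hT hn hx).1
  have hfA {n : ℕ} (hn : 0 < n) : IntegrableOn (fun x ↦ f x * A n x) (Set.Ioc 0 T) := by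
    refine Integrable.of_bound (hf.mul (hA n).aestronglyMeasurable) (M * M) ?_
    filter_upwards [ae_restrict_mem measurableSet_Ioc] with x hx
    rw [norm_mul]
    exact mul_le_mul (hfM x hx) (hAM hn hx) (abs_nonneg _) hM
  have hsum {n : ℕ} (hn : 0 < n) : (∑ i ∈ Finset.range n,
      (∫ x in (i * (T / n))..((i + 1 : ℕ) * (T / n)), f x) *
        ∫ x in (i * (T / n))..((i + 1 : ℕ) * (T / n)), g x) / (T / n) =
      ∫ x in Set.Ioc 0 T, f x * A n x := by
    have hn' : (0 : ℝ) < n := by exact_mod_cast hn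
    have hh : 0 < T / n := by positivity
    have hle (k : ℕ) : (k : ℝ) * (T / n) ≤ (k + 1 : ℕ) * (T / n) := by push_cast; nlinarith
    have h1 := intervalIntegral.sum_integral_adjacent_intervals
      (f := fun x ↦ f x * A n x) (μ := volume) (a := fun k : ℕ ↦ (k : ℝ) * (T / n)) (n := n)
      fun k hk ↦ (intervalIntegrable_iff_integrableOn_Ioc_of_le (hle k)).2
        ((hfA hn).mono_set (hcell hn hk))
    simp only [Nat.cast_zero, zero_mul] at h1
    rw [show (n : ℝ) * (T / n) = T by field_simp, intervalIntegral.integral_of_le hT.le] at h1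
    rw [← h1, Finset.sum_div]
    refine Finset.sum_congr rfl fun k _ ↦ ?_
    rw [mul_div_assoc, ← intervalIntegral.integral_mul_const]
    change ∫ x in (k * (T / n))..((k + 1 : ℕ) * (T / n)), f x * c n k = _
    rw [intervalIntegral.integral_of_le (hle k), intervalIntegral.integral_of_le (hle k)]
    refine setIntegral_congr_fun measurableSet_Ioc fun x hx ↦ ?_
    simp only [A, ceil_div_sub_one_eq hh hx]
  have hlim : Tendsto (fun n ↦ ∫ x in Set.Ioc 0 T, f x * A n x) atTop
      (𝓝 (∫ x in Set.Ioc 0 T, f x * g x)) := by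
    refine tendsto_integral_filter_of_dominated_convergence (fun _ ↦ M * M)
      (.of_forall fun n ↦ hf.mul (hA n).aestronglyMeasurable) ?_ (integrable_const _) ?_
    · filter_upwards [eventually_gt_atTop 0] with n hn
      filter_upwards [ae_restrict_mem measurableSet_Ioc] with x hx
      rw [norm_mul]
      exact mul_le_mul (hfM x hx) (hAM hn hx) (abs_nonneg _) hM
    have hgi : IntegrableOn g (Set.Ioc 0 T) := by
      refine Integrable.of_bound hg M ?_
      exact (ae_restrict_mem (s := Set.Ioc 0 T) measurableSet_Ioc).mono fun x hx ↦ hgM x hx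
    have hloc : LocallyIntegrable ((Set.Ioc 0 T).indicator g) volume :=
      (hgi.integrable_indicator measurableSet_Ioc).locallyIntegrable
    -- Lebesgue differentiation with moving centres: the closed cell is the ball of radius `h/2`
    -- about its midpoint, and it contains `x`.
    filter_upwards [ae_restrict_of_ae (s := Set.Ioc 0 T) (IsUnifLocDoublingMeasure.ae_tendsto_average volume hloc 1),
      ae_restrict_mem measurableSet_Ioc] with x hx hxT
    refine Tendsto.const_mul _ ?_
    have h1 := hx (l := atTop)
      (fun n : ℕ ↦ (((⌈x / (T / n)⌉₊ - 1 : ℕ) : ℝ) + 1 / 2) * (T / n))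
      (fun n : ℕ ↦ T / n / 2) ?_ ?_
    · rw [Set.indicator_of_mem hxT] at h1
      refine h1.congr' ?_
      filter_upwards [eventually_gt_atTop 0] with n hn
      have hn' : (0 : ℝ) < n := by exact_mod_cast hn
      have hh : 0 < T / n := by positivity
      obtain ⟨hk, -⟩ := mem_cell_of_mem_Ioc hT hn hxT
      simp only [A, c]
      set k := ⌈x / (T / n)⌉₊ - 1
      have hle : (k : ℝ) * (T / n) ≤ (k + 1 : ℕ) * (T / n) := by push_cast; nlinarith
      rw [Real.closedBall_eq_Icc, setAverage_eq, integral_Icc_eq_integral_Ioc, Measure.real,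
        Real.volume_Icc, ENNReal.toReal_ofReal (by linarith), smul_eq_mul,
        intervalIntegral.integral_of_le hle,
        show ((k : ℝ) + 1 / 2) * (T / n) - T / n / 2 = k * (T / n) by ring,
        show ((k : ℝ) + 1 / 2) * (T / n) + T / n / 2 = (k + 1 : ℕ) * (T / n) by push_cast; ring,
        show ((k + 1 : ℕ) : ℝ) * (T / n) - k * (T / n) = T / n by push_cast; ring,
        setIntegral_congr_fun (g := g) measurableSet_Ioc
          (fun y hy ↦ Set.indicator_of_mem (hcell hn hk hy) g)]
      ring
    · refine tendsto_nhdsWithin_iff.2 ⟨?_, ?_⟩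
      · simpa using (tendsto_const_div_atTop_nhds_zero_nat T).div_const 2
      · filter_upwards [eventually_gt_atTop 0] with n hn
        have hn' : (0 : ℝ) < n := by exact_mod_cast hn
        exact Set.mem_Ioi.2 (by positivity)
    · filter_upwards [eventually_gt_atTop 0] with n hn
      obtain ⟨-, h2, h3⟩ := mem_cell_of_mem_Ioc hT hn hxT
      rw [Real.closedBall_eq_Icc]
      push_cast at h3
      constructor <;> linarith
  rw [intervalIntegral.integral_of_le hT.le]
  refine hlim.congr' ?_
  filter_upwards [eventually_gt_atTop 0] with n hn
  exact (hsum hn).symm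

end RiemannSums

end JumpDiffusion

namespace JumpDiffusion

/-! ### Decay rates in the mesh -/

section Rates

lemma tendsto_log_mesh {T : ℝ} (hT : 0 < T) :
    Tendsto (fun n : ℕ ↦ Real.log (1 / (T / n))) atTop atTop := by
  refine Real.tendsto_log_atTop.comp ?_
  simp only [one_div_div]
  exact tendsto_natCast_atTop_atTop.atTop_div_const hT

lemma exp_neg_log_mesh {T : ℝ} (hT : 0 < T) {n : ℕ} (hn : 0 < n) :
    Real.exp (-Real.log (1 / (T / n))) = T / n := by
  have hn' : (0 : ℝ) < n := by exact_mod_cast hn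
  rw [one_div, Real.log_inv, neg_neg, Real.exp_log (by positivity)]

lemma tendsto_pow_log_mul_mesh {T : ℝ} (hT : 0 < T) (k : ℕ) :
    Tendsto (fun n : ℕ ↦ Real.log (1 / (T / n)) ^ k * (T / n)) atTop (𝓝 0) := by
  refine ((Real.tendsto_pow_mul_exp_neg_atTop_nhds_zero k).comp (tendsto_log_mesh hT)).congr' ?_
  filter_upwards [eventually_gt_atTop 0] with n hn
  simp only [Function.comp_apply]
  rw [exp_neg_log_mesh hT hn]

/-- With `h = T / n` the quotient is `h^{q-1}`, so the Gaussian tail is negligible once `q > 1`. -/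
lemma tendsto_exp_neg_mul_log_div_mesh {T q : ℝ} (hT : 0 < T) (hq : 1 < q) :
    Tendsto (fun n : ℕ ↦ Real.exp (-(q * Real.log (1 / (T / n)))) / (T / n)) atTop (𝓝 0) := by
  have h : Tendsto (fun n : ℕ ↦ Real.exp (-((q - 1) * Real.log (1 / (T / n))))) atTop (𝓝 0) :=
    Real.tendsto_exp_neg_atTop_nhds_zero.comp
      ((tendsto_log_mesh hT).const_mul_atTop (sub_pos.2 hq))
  refine h.congr' ?_
  filter_upwards [eventually_gt_atTop 0] with n hn
  have hd : Real.exp (-(q * Real.log (1 / (T / n)))) / (T / n) =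
      Real.exp (-(q * Real.log (1 / (T / n)))) / Real.exp (-Real.log (1 / (T / n))) := by
    rw [exp_neg_log_mesh hT hn]
  rw [hd, ← Real.exp_sub]
  ring_nf

lemma tendsto_rate_sq {T : ℝ} (hT : 0 < T) :
    Tendsto (fun n : ℕ ↦ √(T / n * Real.log (1 / (T / n))) ^ 2) atTop (𝓝 0) := by
  refine (tendsto_pow_log_mul_mesh hT 1).congr' ?_
  filter_upwards [(tendsto_log_mesh hT).eventually_ge_atTop 0] with n hl
  rw [Real.sq_sqrt (by positivity)]
  ring

lemma tendsto_rate_pow_four_div_mesh {T : ℝ} (hT : 0 < T) :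
    Tendsto (fun n : ℕ ↦ √(T / n * Real.log (1 / (T / n))) ^ 4 / (T / n)) atTop (𝓝 0) := by
  refine (tendsto_pow_log_mul_mesh hT 2).congr' ?_
  filter_upwards [(tendsto_log_mesh hT).eventually_ge_atTop 0, eventually_gt_atTop 0] with n hl hn
  have hn' : (0 : ℝ) < n := by exact_mod_cast hn
  rw [show 4 = 2 * 2 from rfl, pow_mul, Real.sq_sqrt (by positivity)]
  field_simp

lemma tendsto_rate_pow_three_div_mesh {T : ℝ} (hT : 0 < T) :
    Tendsto (fun n : ℕ ↦ √(T / n * Real.log (1 / (T / n))) ^ 3 / (T / n)) atTop (𝓝 0) := by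
  have h := (tendsto_pow_log_mul_mesh hT 3).sqrt
  rw [Real.sqrt_zero] at h
  refine h.congr' ?_
  filter_upwards [(tendsto_log_mesh hT).eventually_ge_atTop 0, eventually_gt_atTop 0] with n hl hn
  have hn' : (0 : ℝ) < n := by exact_mod_cast hn
  rw [Real.sqrt_eq_iff_mul_self_eq (by positivity) (by positivity), ← sq, div_pow, ← pow_mul,
    show 3 * 2 = 2 * 3 from rfl, pow_mul, Real.sq_sqrt (by positivity)]
  field_simp

end Rates

/-! ### Variance under a negligible perturbation -/

section VariancePerturbation

variable {Ω : Type*} [MeasurableSpace Ω] {P : Measure Ω}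

/-- The variance of `A + t D` is a nonnegative quadratic in `t`, so its discriminant is nonpositive.
-/
lemma covariance_sq_le [IsProbabilityMeasure P] {A D : Ω → ℝ} (hA : MemLp A 2 P)
    (hD : MemLp D 2 P) : cov[A, D; P] ^ 2 ≤ Var[A; P] * Var[D; P] := by
  have h (t : ℝ) : 0 ≤ Var[D; P] * (t * t) + 2 * cov[A, D; P] * t + Var[A; P] := by
    have h1 := variance_nonneg (fun ω ↦ A ω + t * D ω) P
    rw [variance_fun_add hA (hD.const_mul t), variance_const_mul,
      covariance_const_mul_right] at h1
    linarith
  have := discrim_le_zero h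
  rw [discrim] at this
  nlinarith

lemma tendsto_variance_add_div [IsProbabilityMeasure P] {A D : ℕ → Ω → ℝ} {h : ℕ → ℝ} {a : ℝ}
    (hA : ∀ n, MemLp (A n) 2 P) (hD : ∀ n, MemLp (D n) 2 P)
    (hvA : Tendsto (fun n ↦ Var[A n; P] / h n) atTop (𝓝 a))
    (hvD : Tendsto (fun n ↦ Var[D n; P] / h n) atTop (𝓝 0)) :
    Tendsto (fun n ↦ Var[fun ω ↦ A n ω + D n ω; P] / h n) atTop (𝓝 a) := by
  have hs : Tendsto (fun n ↦ √(Var[A n; P] / h n * (Var[D n; P] / h n))) atTop (𝓝 0) := by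
    simpa using (hvA.mul hvD).sqrt
  have hc : Tendsto (fun n ↦ cov[A n, D n; P] / h n) atTop (𝓝 0) := by
    refine squeeze_zero_norm (fun n ↦ ?_) hs
    refine Real.le_sqrt_of_sq_le ?_
    rw [Real.norm_eq_abs, sq_abs, div_pow, div_mul_div_comm, ← sq]
    exact div_le_div_of_nonneg_right (covariance_sq_le (hA n) (hD n)) (sq_nonneg _)
  have := (hvA.add (hc.const_mul 2)).add hvD
  simp only [mul_zero, add_zero] at this
  refine this.congr fun n ↦ ?_
  rw [variance_fun_add (hA n) (hD n)]
  ring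

end VariancePerturbation

/-! ### Bias and variance for triangular arrays of jump increments -/

section IncrementArray

variable {Ω : Type*} [MeasurableSpace Ω]

/-- A triangular array of jump increments over cells of length `T / n` whose parameters are of the
order of the cell length. -/
structure IsIncrementArray (P : Measure Ω) (T : ℝ) (G : ℕ → ℕ → Ω → ℝ) (count : ℕ → ℕ → Ω → ℕ)
    (ζ : ℕ → Ω → ℝ) (g : ℕ → ℕ → ℝ) (v L : ℕ → ℕ → ℝ≥0) (M C : ℝ) (Δ : ℕ → ℕ → Ω → ℝ)
    (total : Ω → ℝ) : Prop where
  increment : ∀ n i, IsJumpIncrement P (G n i) (count n i) (count n (i + 1)) ζ (g n i) (v n i)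
    (L n i) M (Δ n i)
  indep : ∀ n i j, i < j → IndepFun (G n i) (G n j) P
  count_mono : ∀ n, ∀ᵐ ω ∂P, Monotone fun i ↦ count n i ω
  count_le : ∀ n, 0 < n → ∀ᵐ ω ∂P, (count n n ω : ℝ) - count n 0 ω ≤ total ω
  total_memLp : MemLp total 2 P
  drift_nonneg : ∀ n i, i < n → 0 ≤ g n i
  drift_le : ∀ n i, i < n → g n i ≤ C * (T / n)
  var_ne_zero : ∀ n i, i < n → v n i ≠ 0
  var_le : ∀ n i, i < n → v n i ≤ C * (T / n)
  intensity_le : ∀ n i, i < n → L n i ≤ C * (T / n)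

/-- Thresholds above the Gaussian fluctuations by a factor `√κ` and of the order
`√(h log (1 / h))`. -/
def IsAdmissibleThreshold (T κ C : ℝ) (g : ℕ → ℕ → ℝ) (v : ℕ → ℕ → ℝ≥0) (B : ℕ → ℕ → ℝ) : Prop :=
  ∀ᶠ n in atTop, ∀ i < n,
    √(κ * v n i * Real.log (1 / (T / n))) + g n i ≤ B n i ∧
    g n i ≤ √(κ * v n i * Real.log (1 / (T / n))) ∧
    B n i ≤ C * √(T / n * Real.log (1 / (T / n)))

/-- If `|g + y| > B`, then `|y| > √κvl ≥ g`; hence `|g + y| ≤ 2 |y|`, the source of the factor `4`.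
-/
lemma sub_truncSq_le {g x y κvl B : ℝ} (hg : 0 ≤ g) (hg' : g ≤ √κvl) (hB : √κvl + g ≤ B)
    (hx : x = (g + y) ^ 2 - truncSq B (g + y)) :
    x ≤ if κvl < y ^ 2 then 4 * y ^ 2 else 0 := by
  by_cases h : |g + y| ≤ B
  · rw [hx, truncSq, if_pos h, sub_self]
    split_ifs <;> positivity
  · have h1 : √κvl < |y| := by
      have := abs_add_le g y
      rw [abs_of_nonneg hg] at this
      linarith
    have h2 : κvl < y ^ 2 := by
      rw [← sq_abs]
      exact (Real.sqrt_lt' ((Real.sqrt_nonneg _).trans_lt h1)).1 h1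
    rw [hx, truncSq, if_neg h, if_pos h2, sub_zero]
    have h3 : |g + y| ≤ 2 * |y| := by
      have := abs_add_le g y
      rw [abs_of_nonneg hg] at this
      linarith
    calc (g + y) ^ 2 = |g + y| ^ 2 := (sq_abs _).symm
      _ ≤ (2 * |y|) ^ 2 := by gcongr
      _ = 4 * y ^ 2 := by rw [mul_pow, sq_abs]; norm_num

namespace IsIncrementArray

variable {P : Measure Ω} {T : ℝ} {G : ℕ → ℕ → Ω → ℝ} {count : ℕ → ℕ → Ω → ℕ}
  {ζ : ℕ → Ω → ℝ} {g : ℕ → ℕ → ℝ} {v L : ℕ → ℕ → ℝ≥0} {M C : ℝ} {Δ : ℕ → ℕ → Ω → ℝ}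
  {total : Ω → ℝ}

lemma memLp_sum_truncSq [IsProbabilityMeasure P]
    (h : IsIncrementArray P T G count ζ g v L M C Δ total)
    (B : ℕ → ℕ → ℝ) (n : ℕ) :
    MemLp (fun ω ↦ ∑ i ∈ Finset.range n, truncSq (B n i) (Δ n i ω)) 2 P := by
  refine memLp_finsetSum _ fun i _ ↦ ?_
  refine MemLp.of_bound ((measurable_truncSq _).comp_aemeasurable
    (h.increment n i).aemeasurable).aestronglyMeasurable (B n i ^ 2) (.of_forall fun ω ↦ ?_)
  rw [Real.norm_of_nonneg (truncSq_nonneg _ _)]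
  exact truncSq_le _ _

/-- The condition `κ > 2` leaves room for `a` with `1 / κ < a < 1 / 2`, and `q = a κ` then exceeds
`1`. The two estimates are the tail bounds for the second and fourth moments. -/
lemma exists_tail_rate {κ : ℝ} (hκ : 2 < κ) : ∃ q C₁ : ℝ, 1 < q ∧ 0 ≤ C₁ ∧
    ∀ {Ω : Type*} [MeasurableSpace Ω] {P : Measure Ω} {G : Ω → ℝ} {v : ℝ≥0} {g B l : ℝ}, v ≠ 0 →
      HasLaw G (gaussianReal 0 v) P → 0 ≤ g → g ≤ √(κ * v * l) → √(κ * v * l) + g ≤ B →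
      ∫ ω, ((g + G ω) ^ 2 - truncSq B (g + G ω)) ∂P ≤ C₁ * v * Real.exp (-(q * l)) ∧
      ∫ ω, ((g + G ω) ^ 2 - truncSq B (g + G ω)) ^ 2 ∂P ≤ C₁ * v ^ 2 * Real.exp (-(q * l)) := by
  obtain ⟨a, ha1, ha2⟩ : ∃ a, 1 / κ < a ∧ a < 1 / 2 :=
    exists_between (one_div_lt_one_div_of_lt two_pos hκ)
  have hκ0 : 0 < κ := by linarith
  have ha0 : 0 ≤ a := (one_div_pos.2 hκ0).le.trans ha1.le
  obtain ⟨C₁, h1, H1⟩ := exists_tail_bound_gaussianReal 1 ha0 ha2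
  obtain ⟨C₂, h2, H2⟩ := exists_tail_bound_gaussianReal 2 ha0 ha2
  refine ⟨a * κ, 4 * C₁ + 16 * C₂, ?_, by positivity,
    fun {Ω _ P G v g B l} hv hG hg hg' hB ↦ ⟨?_, ?_⟩⟩
  · rwa [div_lt_iff₀ hκ0] at ha1
  · refine (H1 (K := 4) (κ := κ) (l := l) hv hG (by norm_num)
      (fun ω ↦ sub_nonneg.2 (truncSq_le_sq _ _))
      fun ω ↦ sub_truncSq_le hg hg' hB rfl).trans ?_
    have hv0 : (0 : ℝ) ≤ v := v.2
    refine mul_le_mul_of_nonneg_right ?_ (Real.exp_pos _).le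
    rw [pow_one]
    nlinarith [mul_nonneg hv0 h2]
  · refine (H2 (K := 16) (κ := κ) (l := l) hv hG (by norm_num)
      (fun ω ↦ sq_nonneg _) fun ω ↦ ?_).trans ?_
    · have h3 := sub_truncSq_le (y := G ω) hg hg' hB rfl
      have h4 : 0 ≤ (g + G ω) ^ 2 - truncSq B (g + G ω) := sub_nonneg.2 (truncSq_le_sq _ _)
      split_ifs at h3 ⊢
      · calc _ ≤ (4 * G ω ^ 2) ^ 2 := by gcongr
          _ = _ := by ring
      · rw [le_antisymm h3 h4]
        norm_num
    · have hv0 : (0 : ℝ) ≤ v := v.2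
      refine mul_le_mul_of_nonneg_right ?_ (Real.exp_pos _).le
      nlinarith [mul_nonneg (sq_nonneg (v : ℝ)) h1]

/-- The bias of the thresholded realized variance of an array. -/
lemma tendsto_bias [IsProbabilityMeasure P]
    (h : IsIncrementArray P T G count ζ g v L M C Δ total) (hT : 0 < T) {B : ℕ → ℕ → ℝ} {κ C' : ℝ}
    (hκ : 2 < κ) (hB : IsAdmissibleThreshold T κ C' g v B) {IV a b : ℝ}
    (hIV : ∀ n, 0 < n → ∑ i ∈ Finset.range n, (v n i : ℝ) = IV)
    (hg : Tendsto (fun n : ℕ ↦ (∑ i ∈ Finset.range n, g n i ^ 2) / (T / n)) atTop (𝓝 a))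
    (hL : Tendsto (fun n : ℕ ↦ (∑ i ∈ Finset.range n, (L n i : ℝ) * v n i) / (T / n)) atTop
      (𝓝 b)) :
    Tendsto (fun n : ℕ ↦ (∫ ω, ∑ i ∈ Finset.range n, truncSq (B n i) (Δ n i ω) ∂P - IV) / (T / n))
      atTop (𝓝 (a - b)) := by
  obtain ⟨q, C₁, hq, hC₁, htail⟩ := exists_tail_rate hκ
  let ℓ (n : ℕ) : ℝ := √(T / n * Real.log (1 / (T / n)))
  have hM : 0 ≤ M := (h.increment 0 0).bound_nonneg
  -- The total error over `n = T / h` cells, divided by `h`. In order: Gaussian tail, the terms `v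
  -- L²` and `g² L`, a single jump below the threshold, several jumps.
  have hrate : Tendsto (fun n : ℕ ↦ T * (C₁ * C *
      (Real.exp (-(q * Real.log (1 / (T / n)))) / (T / n)) + 2 * C ^ 3 * (T / n) +
      2 * C' ^ 3 * M * C * (ℓ n ^ 3 / (T / n)) + C' ^ 2 * C ^ 2 * ℓ n ^ 2)) atTop (𝓝 0) := by
    have := (((((tendsto_exp_neg_mul_log_div_mesh hT hq).const_mul (C₁ * C)).add
      ((tendsto_const_div_atTop_nhds_zero_nat T).const_mul (2 * C ^ 3))).add
      ((tendsto_rate_pow_three_div_mesh hT).const_mul (2 * C' ^ 3 * M * C))).add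
      ((tendsto_rate_sq hT).const_mul (C' ^ 2 * C ^ 2))).const_mul T
    simpa [ℓ] using this
  have hdiff : Tendsto (fun n : ℕ ↦
      (∫ ω, ∑ i ∈ Finset.range n, truncSq (B n i) (Δ n i ω) ∂P - IV) / (T / n) -
      ((∑ i ∈ Finset.range n, g n i ^ 2) / (T / n) -
        (∑ i ∈ Finset.range n, (L n i : ℝ) * v n i) / (T / n))) atTop (𝓝 0) := by
    refine squeeze_zero_norm' ?_ hrate
    filter_upwards [hB, eventually_gt_atTop 0] with n hBn hn
    have hn' : (0 : ℝ) < n := by exact_mod_cast hn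
    have hh : 0 < T / n := by positivity
    have hC : 0 ≤ C * (T / n) := (h.drift_nonneg n 0 hn).trans (h.drift_le n 0 hn)
    have hterm (i : ℕ) (hi : i ∈ Finset.range n) :
        |∫ ω, truncSq (B n i) (Δ n i ω) ∂P - (v n i + g n i ^ 2 - L n i * v n i)| ≤
          C₁ * (C * (T / n)) * Real.exp (-(q * Real.log (1 / (T / n)))) +
          2 * (C * (T / n)) ^ 3 + (C' * ℓ n) ^ 2 *
            (2 * (C' * ℓ n) * M * (C * (T / n)) + (C * (T / n)) ^ 2) := by
      have hi' := Finset.mem_range.1 hi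
      obtain ⟨hB1, hB2, hB3⟩ := hBn i hi'
      have hg0 := h.drift_nonneg n i hi'
      have hB0 : 0 ≤ B n i := (add_nonneg (Real.sqrt_nonneg _) hg0).trans hB1
      have hv1 := h.var_le n i hi'
      have hL1 := h.intensity_le n i hi'
      have hg1 := h.drift_le n i hi'
      have hv0 : (0 : ℝ) ≤ v n i := (v n i).2
      have hL0 : (0 : ℝ) ≤ L n i := (L n i).2
      refine ((h.increment n i).abs_integral_truncSq_sub_le hB0).trans ?_
      have ht := (htail (h.var_ne_zero n i hi') (h.increment n i).law_gauss hg0 hB2 hB1).1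
      have e1 : (v n i : ℝ) * (L n i : ℝ) ^ 2 ≤ (C * (T / n)) * (C * (T / n)) ^ 2 := by gcongr
      have e2 : g n i ^ 2 * (L n i : ℝ) ≤ (C * (T / n)) ^ 2 * (C * (T / n)) := by gcongr
      have e3 : B n i ^ 2 * (2 * B n i * M * L n i + (L n i : ℝ) ^ 2) ≤ (C' * ℓ n) ^ 2 *
            (2 * (C' * ℓ n) * M * (C * (T / n)) + (C * (T / n)) ^ 2) := by
        -- No sign of `C'` is assumed; nonnegativity of `C' * ℓ n` is deduced from `0 ≤ B n i ≤ C' *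
        -- ℓ n`.
        have aux (z : ℝ) (hz : B n i ≤ z) : B n i ^ 2 * (2 * B n i * M * L n i + (L n i : ℝ) ^ 2) ≤
            z ^ 2 * (2 * z * M * (C * (T / n)) + (C * (T / n)) ^ 2) := by
          have hz0 : 0 ≤ z := hB0.trans hz
          gcongr
        exact aux _ hB3
      have e4 : C₁ * v n i * Real.exp (-(q * Real.log (1 / (T / n)))) ≤
          C₁ * (C * (T / n)) * Real.exp (-(q * Real.log (1 / (T / n)))) := by gcongr
      have e5 : (C * (T / n)) * (C * (T / n)) ^ 2 + (C * (T / n)) ^ 2 * (C * (T / n)) =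
        2 * (C * (T / n)) ^ 3 := by ring
      linarith
    have hsum : |∫ ω, ∑ i ∈ Finset.range n, truncSq (B n i) (Δ n i ω) ∂P - IV -
        (∑ i ∈ Finset.range n, g n i ^ 2 - ∑ i ∈ Finset.range n, (L n i : ℝ) * v n i)| ≤
        n * (C₁ * (C * (T / n)) * Real.exp (-(q * Real.log (1 / (T / n)))) +
          2 * (C * (T / n)) ^ 3 + (C' * ℓ n) ^ 2 *
            (2 * (C' * ℓ n) * M * (C * (T / n)) + (C * (T / n)) ^ 2)) := by
      rw [integral_finsetSum _ fun i _ ↦ IsJumpIncrement.integrable_truncSq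
        (h.increment n i).aemeasurable _, ← hIV n hn, sub_sub, ← Finset.sum_sub_distrib,
        ← Finset.sum_add_distrib, ← Finset.sum_sub_distrib]
      simp only [add_sub_assoc] at hterm
      refine (Finset.abs_sum_le_sum_abs _ _).trans ((Finset.sum_le_sum hterm).trans_eq ?_)
      rw [Finset.sum_const, Finset.card_range, nsmul_eq_mul]
    rw [← sub_div, ← sub_div, norm_div, Real.norm_of_nonneg hh.le, div_le_iff₀ hh]
    refine hsum.trans_eq ?_
    field_simp
    ring
  have := hdiff.add (hg.sub hL)
  rw [zero_add] at this
  exact this.congr fun n ↦ by ring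

/-- Each cell where the count changes contributes at least one to the telescoping sum of increments.
-/
lemma sum_jump_indicator_le {N : ℕ → ℕ} (hN : Monotone N) (n : ℕ) :
    ∑ i ∈ Finset.range n, (if N (i + 1) = N i then (0 : ℝ) else 1) ≤ (N n : ℝ) - N 0 := by
  rw [← Finset.sum_range_sub (fun i ↦ (N i : ℝ)) n]
  refine Finset.sum_le_sum fun i _ ↦ ?_
  split_ifs with h
  · rw [h, sub_self]
  · have : N i + 1 ≤ N (i + 1) := Nat.lt_of_le_of_ne (hN (Nat.le_succ i)) (Ne.symm h)
    rw [le_sub_iff_add_le, add_comm]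
    exact_mod_cast this

lemma variance_sum_sq [IsProbabilityMeasure P]
    (h : IsIncrementArray P T G count ζ g v L M C Δ total) (n : ℕ) :
    Var[fun ω ↦ ∑ i ∈ Finset.range n, (g n i + G n i ω) ^ 2; P] =
      ∑ i ∈ Finset.range n, (2 * (v n i : ℝ) ^ 2 + 4 * g n i ^ 2 * v n i) := by
  have h1 (i : ℕ) := variance_add_sq_of_hasLaw_gaussianReal (h.increment n i).law_gauss (g n i)
  have hind : ((Finset.range n : Finset ℕ) : Set ℕ).Pairwise fun i j ↦
      IndepFun (fun ω ↦ (g n i + G n i ω) ^ 2) (fun ω ↦ (g n j + G n j ω) ^ 2) P := by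
    intro i _ j _ hij
    have hlt {i j : ℕ} (hij : i < j) :
        IndepFun (fun ω ↦ (g n i + G n i ω) ^ 2) (fun ω ↦ (g n j + G n j ω) ^ 2) P :=
      (h.indep n i j hij).comp (φ := fun x ↦ (g n i + x) ^ 2) (ψ := fun x ↦ (g n j + x) ^ 2)
        (by fun_prop) (by fun_prop)
    rcases lt_or_gt_of_ne hij with h2 | h2
    · exact hlt h2
    · exact (hlt h2).symm
  have h2 := IndepFun.variance_sum (fun i _ ↦ (h1 i).1) hind
  have h3 : (∑ i ∈ Finset.range n, fun ω ↦ (g n i + G n i ω) ^ 2) =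
      fun ω ↦ ∑ i ∈ Finset.range n, (g n i + G n i ω) ^ 2 := by
    ext ω
    simp
  rw [← h3, h2]
  exact Finset.sum_congr rfl fun i _ ↦ (h1 i).2

/-- Removing the jumps inside the truncation costs at most `B²` in each cell with a jump, hence `b ·
total`; removing the truncation then costs `∑ U i`. The latter sum is handled by Cauchy–Schwarz
without independence: the loss of a factor `n` is affordable since the Gaussian tail is so small. -/
lemma integral_sq_difference_le [IsProbabilityMeasure P]
    (h : IsIncrementArray P T G count ζ g v L M C Δ total) {n : ℕ} (hn : 0 < n) {B : ℕ → ℝ}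
    {b u : ℝ} (hB : ∀ i < n, B i ^ 2 ≤ b)
    (hu : ∀ i < n, ∫ ω, ((g n i + G n i ω) ^ 2 - truncSq (B i) (g n i + G n i ω)) ^ 2 ∂P ≤ u) :
    ∫ ω, (∑ i ∈ Finset.range n, truncSq (B i) (Δ n i ω) -
      ∑ i ∈ Finset.range n, (g n i + G n i ω) ^ 2) ^ 2 ∂P ≤
      2 * b ^ 2 * ∫ ω, total ω ^ 2 ∂P + 2 * n ^ 2 * u := by
  have hb : 0 ≤ b := (sq_nonneg _).trans (hB 0 hn)
  let U (i : ℕ) (ω : Ω) : ℝ := (g n i + G n i ω) ^ 2 - truncSq (B i) (g n i + G n i ω)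
  have hU0 (i : ℕ) (ω : Ω) : 0 ≤ U i ω := sub_nonneg.2 (truncSq_le_sq _ _)
  have hUm (i : ℕ) : MemLp (U i) 2 P := by
    refine (variance_add_sq_of_hasLaw_gaussianReal (h.increment n i).law_gauss (g n i)).1.sub
      (MemLp.of_bound ((measurable_truncSq _).comp_aemeasurable
        ((h.increment n i).law_gauss.aemeasurable.const_add _)).aestronglyMeasurable (B i ^ 2)
        (.of_forall fun ω ↦ ?_))
    rw [Real.norm_of_nonneg (truncSq_nonneg _ _)]
    exact truncSq_le _ _
  have hpoint : ∀ᵐ ω ∂P, (∑ i ∈ Finset.range n, truncSq (B i) (Δ n i ω) -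
      ∑ i ∈ Finset.range n, (g n i + G n i ω) ^ 2) ^ 2 ≤
      2 * b ^ 2 * total ω ^ 2 + 2 * n * ∑ i ∈ Finset.range n, U i ω ^ 2 := by
    have hall : ∀ᵐ ω ∂P, ∀ i, |truncSq (B i) (Δ n i ω) - truncSq (B i) (g n i + G n i ω)| ≤
        B i ^ 2 * if count n (i + 1) ω = count n i ω then 0 else 1 :=
      ae_all_iff.2 fun i ↦ (h.increment n i).abs_truncSq_sub_le (B i)
    filter_upwards [hall, h.count_mono n, h.count_le n hn] with ω h1 h2 h3
    have e1 : |∑ i ∈ Finset.range n, truncSq (B i) (Δ n i ω) -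
        ∑ i ∈ Finset.range n, (g n i + G n i ω) ^ 2| ≤
        b * total ω + ∑ i ∈ Finset.range n, U i ω := by
      rw [← Finset.sum_sub_distrib]
      calc |∑ i ∈ Finset.range n, (truncSq (B i) (Δ n i ω) - (g n i + G n i ω) ^ 2)|
          ≤ ∑ i ∈ Finset.range n, |truncSq (B i) (Δ n i ω) - (g n i + G n i ω) ^ 2| :=
            Finset.abs_sum_le_sum_abs _ _
        _ ≤ ∑ i ∈ Finset.range n,
            (b * (if count n (i + 1) ω = count n i ω then 0 else 1) + U i ω) := by
            refine Finset.sum_le_sum fun i hi ↦ ?_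
            have h4 : truncSq (B i) (Δ n i ω) - (g n i + G n i ω) ^ 2 =
                (truncSq (B i) (Δ n i ω) - truncSq (B i) (g n i + G n i ω)) - U i ω := by
              simp only [U]
              ring
            rw [h4]
            refine (abs_sub _ _).trans (add_le_add ((h1 i).trans ?_)
              (abs_of_nonneg (hU0 i ω)).le)
            exact mul_le_mul_of_nonneg_right (hB i (Finset.mem_range.1 hi))
              (by split_ifs <;> norm_num)
        _ ≤ b * total ω + ∑ i ∈ Finset.range n, U i ω := by
            rw [Finset.sum_add_distrib, ← Finset.mul_sum]
            gcongr
            exact (sum_jump_indicator_le h2 n).trans h3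
    calc _ = |∑ i ∈ Finset.range n, truncSq (B i) (Δ n i ω) -
        ∑ i ∈ Finset.range n, (g n i + G n i ω) ^ 2| ^ 2 := (sq_abs _).symm
      _ ≤ (b * total ω + ∑ i ∈ Finset.range n, U i ω) ^ 2 := by gcongr
      _ ≤ 2 * ((b * total ω) ^ 2 + (∑ i ∈ Finset.range n, U i ω) ^ 2) := add_sq_le
      _ ≤ 2 * ((b * total ω) ^ 2 + n * ∑ i ∈ Finset.range n, U i ω ^ 2) := by
          have := sq_sum_le_card_mul_sum_sq (s := Finset.range n) (f := fun i ↦ U i ω)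
          rw [Finset.card_range] at this
          gcongr
      _ = _ := by ring
  have hi1 : Integrable (fun ω ↦ total ω ^ 2) P := h.total_memLp.integrable_sq
  have hi2 : Integrable (fun ω ↦ ∑ i ∈ Finset.range n, U i ω ^ 2) P :=
    integrable_finsetSum _ fun i _ ↦ (hUm i).integrable_sq
  refine (integral_mono_of_nonneg (.of_forall fun ω ↦ sq_nonneg _)
    ((hi1.const_mul _).add (hi2.const_mul _)) hpoint).trans ?_
  simp only [Pi.add_apply]
  rw [integral_add (hi1.const_mul _) (hi2.const_mul _), integral_const_mul, integral_const_mul,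
    integral_finsetSum _ fun i _ ↦ (hUm i).integrable_sq]
  have hs : ∑ i ∈ Finset.range n, ∫ ω, U i ω ^ 2 ∂P ≤ n * u :=
    (Finset.sum_le_sum fun i hi ↦ hu i (Finset.mem_range.1 hi)).trans_eq (by simp)
  have : 2 * (n : ℝ) * ∑ i ∈ Finset.range n, ∫ ω, U i ω ^ 2 ∂P ≤ 2 * n * (n * u) := by gcongr
  linarith

/-- The variance of the thresholded realized variance of an array. -/
lemma tendsto_variance [IsProbabilityMeasure P]
    (h : IsIncrementArray P T G count ζ g v L M C Δ total) (hT : 0 < T) {B : ℕ → ℕ → ℝ} {κ C' : ℝ}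
    (hκ : 2 < κ) (hB : IsAdmissibleThreshold T κ C' g v B) {a : ℝ}
    (hv : Tendsto (fun n : ℕ ↦ (∑ i ∈ Finset.range n, (v n i : ℝ) ^ 2) / (T / n)) atTop (𝓝 a)) :
    Tendsto (fun n : ℕ ↦ Var[fun ω ↦ ∑ i ∈ Finset.range n, truncSq (B n i) (Δ n i ω); P] / (T / n))
      atTop (𝓝 (2 * a)) := by
  obtain ⟨q, C₁, hq, hC₁, htail⟩ := exists_tail_rate hκ
  let ℓ (n : ℕ) : ℝ := √(T / n * Real.log (1 / (T / n)))
  let A (n : ℕ) (ω : Ω) : ℝ := ∑ i ∈ Finset.range n, (g n i + G n i ω) ^ 2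
  let D (n : ℕ) (ω : Ω) : ℝ := ∑ i ∈ Finset.range n, truncSq (B n i) (Δ n i ω) - A n ω
  have hA (n : ℕ) : MemLp (A n) 2 P := memLp_finsetSum _ fun i _ ↦
    (variance_add_sq_of_hasLaw_gaussianReal (h.increment n i).law_gauss (g n i)).1
  have hD (n : ℕ) : MemLp (D n) 2 P := (h.memLp_sum_truncSq B n).sub (hA n)
  have hvA : Tendsto (fun n ↦ Var[A n; P] / (T / n)) atTop (𝓝 (2 * a)) := by
    -- The drift enters the variance through `n` terms of order `h³`, which is `O(h²)` in total.
    have h0 : Tendsto (fun n : ℕ ↦ (∑ i ∈ Finset.range n, 4 * g n i ^ 2 * v n i) / (T / n))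
        atTop (𝓝 0) := by
      refine squeeze_zero' (.of_forall fun n ↦ by positivity) ?_
        (by simpa using (tendsto_const_div_atTop_nhds_zero_nat T).const_mul (4 * C ^ 3 * T))
      filter_upwards [eventually_gt_atTop 0] with n hn
      have hn' : (0 : ℝ) < n := by exact_mod_cast hn
      have hh : 0 < T / n := by positivity
      rw [div_le_iff₀ hh]
      calc ∑ i ∈ Finset.range n, 4 * g n i ^ 2 * v n i
          ≤ ∑ i ∈ Finset.range n, 4 * (C * (T / n)) ^ 2 * (C * (T / n)) := by
            refine Finset.sum_le_sum fun i hi ↦ ?_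
            have hi' := Finset.mem_range.1 hi
            have := h.drift_nonneg n i hi'
            have := h.drift_le n i hi'
            have := h.var_le n i hi'
            gcongr
        _ = 4 * C ^ 3 * T * (T / n) * (T / n) := by
            rw [Finset.sum_const, Finset.card_range, nsmul_eq_mul]
            field_simp
    have := (hv.const_mul 2).add h0
    rw [add_zero] at this
    refine this.congr fun n ↦ ?_
    simp only [A]
    rw [h.variance_sum_sq, Finset.sum_add_distrib, ← Finset.mul_sum]
    ring
  have hvD : Tendsto (fun n ↦ Var[D n; P] / (T / n)) atTop (𝓝 0) := by
    -- The first term comes from `b² = (C' ℓ)⁴`, the second from the Gaussian tail with `n² h² =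
    -- T²`.
    have hrate : Tendsto (fun n : ℕ ↦ 2 * C' ^ 4 * (∫ ω, total ω ^ 2 ∂P) * (ℓ n ^ 4 / (T / n)) +
        2 * C₁ * C ^ 2 * T ^ 2 * (Real.exp (-(q * Real.log (1 / (T / n)))) / (T / n))) atTop
        (𝓝 0) := by
      simpa [ℓ] using ((tendsto_rate_pow_four_div_mesh hT).const_mul
        (2 * C' ^ 4 * (∫ ω, total ω ^ 2 ∂P))).add
        ((tendsto_exp_neg_mul_log_div_mesh hT hq).const_mul (2 * C₁ * C ^ 2 * T ^ 2))
    refine squeeze_zero' (.of_forall fun n ↦ div_nonneg (variance_nonneg _ _) (by positivity)) ?_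
      hrate
    filter_upwards [hB, eventually_gt_atTop 0] with n hBn hn
    have hn' : (0 : ℝ) < n := by exact_mod_cast hn
    have hh : 0 < T / n := by positivity
    rw [div_le_iff₀ hh]
    refine (variance_le_expectation_sq (hD n).1).trans ?_
    simp only [Pi.pow_apply]
    refine (h.integral_sq_difference_le hn (b := (C' * ℓ n) ^ 2)
      (u := C₁ * (C * (T / n)) ^ 2 * Real.exp (-(q * Real.log (1 / (T / n)))))
      (fun i hi ↦ ?_) fun i hi ↦ ?_).trans_eq ?_
    · obtain ⟨hB1, -, hB3⟩ := hBn i hi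
      have hB0 : 0 ≤ B n i := (add_nonneg (Real.sqrt_nonneg _) (h.drift_nonneg n i hi)).trans hB1
      gcongr
    · obtain ⟨hB1, hB2, -⟩ := hBn i hi
      refine (htail (h.var_ne_zero n i hi) (h.increment n i).law_gauss (h.drift_nonneg n i hi) hB2
        hB1).2.trans ?_
      have := h.var_le n i hi
      gcongr
    · field_simp
  refine (tendsto_variance_add_div hA hD hvA hvD).congr fun n ↦ ?_
  simp [D]

end IsIncrementArray

end IncrementArray

end JumpDiffusion

namespace JumpDiffusion

/-! ### Integrals of the coefficients over the cells -/

section Coefficients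

lemma coe_mesh (T : ℝ≥0) (n : ℕ) : (mesh T n : ℝ) = T / n := by simp [mesh]

lemma coe_obsTime (T : ℝ≥0) (n i : ℕ) : (obsTime T n i : ℝ) = i * ((T : ℝ) / n) := by
  simp [obsTime, mesh]

lemma obsTime_zero (T : ℝ≥0) (n : ℕ) : obsTime T n 0 = 0 := by simp [obsTime]

lemma obsTime_self (T : ℝ≥0) {n : ℕ} (hn : 0 < n) : obsTime T n n = T := by
  have : (n : ℝ≥0) ≠ 0 := by exact_mod_cast hn.ne'
  rw [obsTime, mesh, mul_div_cancel₀ _ this]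

lemma obsTime_mono (T : ℝ≥0) (n : ℕ) : Monotone (obsTime T n) := fun i j hij ↦ by
  unfold obsTime
  gcongr

lemma obsTime_le (T : ℝ≥0) {n i : ℕ} (hn : 0 < n) (hi : i ≤ n) : obsTime T n i ≤ T :=
  (obsTime_mono T n hi).trans_eq (obsTime_self T hn)

lemma PositiveLocallyBounded.intervalIntegrable {f : ℝ → ℝ} (hf : PositiveLocallyBounded f)
    (hm : AEStronglyMeasurable f (volume.restrict (Set.Ici 0))) (s t : ℝ≥0) :
    IntervalIntegrable f volume s t := by
  have key (t : ℝ≥0) : IntervalIntegrable f volume 0 t := by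
    rw [intervalIntegrable_iff_integrableOn_Ioc_of_le t.coe_nonneg]
    rcases eq_or_lt_of_le t.coe_nonneg with ht | ht
    · simp [← ht]
    obtain ⟨m, M, hm0, hM⟩ := hf t ht
    refine Integrable.of_bound (hm.mono_measure (Measure.restrict_mono
      (fun x hx ↦ (le_of_lt hx.1 : (0 : ℝ) ≤ x)) le_rfl)) M ?_
    refine (ae_restrict_mem measurableSet_Ioc).mono fun x hx ↦ ?_
    obtain ⟨h1, h2⟩ := hM x ⟨hx.1.le, hx.2⟩
    rwa [Real.norm_of_nonneg (hm0.le.trans h1)]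
  exact (key s).symm.trans (key t)

lemma PositiveLocallyBounded.sq {f : ℝ → ℝ} (hf : PositiveLocallyBounded f) :
    PositiveLocallyBounded fun x ↦ f x ^ 2 := fun t ht ↦ by
  obtain ⟨m, M, hm0, hM⟩ := hf t ht
  refine ⟨m ^ 2, M ^ 2, by positivity, fun s hs ↦ ?_⟩
  obtain ⟨h1, h2⟩ := hM s hs
  exact ⟨pow_le_pow_left₀ hm0.le h1 2, pow_le_pow_left₀ (hm0.le.trans h1) h2 2⟩

lemma PositiveLocallyBounded.integral_bounds {f : ℝ → ℝ} (hf : PositiveLocallyBounded f)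
    (hm : AEStronglyMeasurable f (volume.restrict (Set.Ici 0))) {T : ℝ≥0} {m M : ℝ}
    (hM : ∀ s ∈ Set.Icc 0 (T : ℝ), m ≤ f s ∧ f s ≤ M) {n i : ℕ} (hi : i < n) :
    m * (T / n) ≤ (∫ x in (obsTime T n i : ℝ)..obsTime T n (i + 1), f x) ∧
    (∫ x in (obsTime T n i : ℝ)..obsTime T n (i + 1), f x) ≤ M * (T / n) := by
  have hle : (obsTime T n i : ℝ) ≤ obsTime T n (i + 1) := obsTime_mono T n (Nat.le_succ i)
  have hT : (obsTime T n (i + 1) : ℝ) ≤ T := obsTime_le T (by omega) hi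
  have hlen : (obsTime T n (i + 1) : ℝ) - obsTime T n i = T / n := by
    rw [coe_obsTime, coe_obsTime]
    push_cast
    ring
  have hmem (x : ℝ) (hx : x ∈ Set.Icc (obsTime T n i : ℝ) (obsTime T n (i + 1))) :
      x ∈ Set.Icc 0 (T : ℝ) := ⟨(obsTime T n i).2.trans hx.1, hx.2.trans hT⟩
  have hint := hf.intervalIntegrable hm (obsTime T n i) (obsTime T n (i + 1))
  constructor
  · have := intervalIntegral.integral_mono_on hle (intervalIntegrable_const (c := m)) hint
      fun x hx ↦ (hM x (hmem x hx)).1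
    rwa [intervalIntegral.integral_const, hlen, smul_eq_mul, mul_comm] at this
  · have := intervalIntegral.integral_mono_on hle hint (intervalIntegrable_const (c := M))
      fun x hx ↦ (hM x (hmem x hx)).2
    rwa [intervalIntegral.integral_const, hlen, smul_eq_mul, mul_comm] at this

lemma PositiveLocallyBounded.integral_nonneg {f : ℝ → ℝ} (hf : PositiveLocallyBounded f)
    {s t : ℝ≥0} (hst : s ≤ t) : 0 ≤ ∫ x in (s : ℝ)..t, f x := by
  refine intervalIntegral.integral_nonneg (NNReal.coe_le_coe.2 hst) fun x hx ↦ ?_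
  -- The bounds are available on `[0, t]` for `t > 0` only, so the point `0` is treated inside `[0,
  -- 1]`.
  rcases eq_or_lt_of_le (s.coe_nonneg.trans hx.1) with h | h
  · obtain ⟨m, M, hm, hM⟩ := hf 1 one_pos
    exact hm.le.trans (hM x ⟨h.le, h ▸ zero_le_one⟩).1
  · obtain ⟨m, M, hm, hM⟩ := hf x h
    exact hm.le.trans (hM x ⟨h.le, le_rfl⟩).1

lemma tendsto_sum_increments {f g : ℝ → ℝ} (hf : PositiveLocallyBounded f)
    (hfm : AEStronglyMeasurable f (volume.restrict (Set.Ici 0))) (hg : PositiveLocallyBounded g)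
    (hgm : AEStronglyMeasurable g (volume.restrict (Set.Ici 0))) {T : ℝ≥0} (hT : 0 < T) :
    Tendsto (fun n : ℕ ↦ (∑ i ∈ Finset.range n,
      (∫ x in (obsTime T n i : ℝ)..obsTime T n (i + 1), f x) *
        ∫ x in (obsTime T n i : ℝ)..obsTime T n (i + 1), g x) / (T / n)) atTop
      (𝓝 (∫ x in (0 : ℝ)..T, f x * g x)) := by
  have hT' : (0 : ℝ) < T := hT
  obtain ⟨m, M, hm, hM⟩ := hf T hT'
  obtain ⟨m', M', hm', hM'⟩ := hg T hT'
  have hsub : volume.restrict (Set.Ioc 0 (T : ℝ)) ≤ volume.restrict (Set.Ici 0) :=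
    Measure.restrict_mono (fun x hx ↦ (le_of_lt hx.1 : (0 : ℝ) ≤ x)) le_rfl
  simp only [coe_obsTime]
  refine tendsto_sum_integral_mul_integral (M := max M M') hT' (hfm.mono_measure hsub)
    (hgm.mono_measure hsub) (fun x hx ↦ ?_) fun x hx ↦ ?_
  · obtain ⟨h1, h2⟩ := hM x ⟨hx.1.le, hx.2⟩
    rw [abs_of_nonneg (hm.le.trans h1)]
    exact h2.trans (le_max_left _ _)
  · obtain ⟨h1, h2⟩ := hM' x ⟨hx.1.le, hx.2⟩
    rw [abs_of_nonneg (hm'.le.trans h1)]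
    exact h2.trans (le_max_right _ _)

lemma CoefficientConditions.volatility_measurable {γ σ lam : ℝ → ℝ}
    (h : CoefficientConditions γ σ lam) :
    AEStronglyMeasurable σ (volume.restrict (Set.Ici 0)) :=
  h.volatility_continuous.aestronglyMeasurable measurableSet_Ici

lemma CoefficientConditions.volatility_memLp {γ σ lam : ℝ → ℝ}
    (h : CoefficientConditions γ σ lam) (t : ℝ≥0) :
    MemLp σ 2 (volume.restrict (Set.Ioc (0 : ℝ) t)) := by
  have hsub : volume.restrict (Set.Ioc 0 (t : ℝ)) ≤ volume.restrict (Set.Ici 0) :=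
    Measure.restrict_mono (fun x hx ↦ (le_of_lt hx.1 : (0 : ℝ) ≤ x)) le_rfl
  rw [memLp_two_iff_integrable_sq (h.volatility_measurable.mono_measure hsub)]
  exact (intervalIntegrable_iff_integrableOn_Ioc_of_le t.2).1
    (h.volatility_bounds.sq.intervalIntegrable (h.volatility_measurable.pow 2) 0 t)

end Coefficients

/-! ### Admissibility of the thresholds -/

section Threshold

variable {γ σ lam : ℝ → ℝ}

/-- The mean of the increment over the cell with index `i`. -/
noncomputable def cellDrift (γ : ℝ → ℝ) (T : ℝ≥0) (n i : ℕ) : ℝ :=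
  ∫ x in (obsTime T n i : ℝ)..obsTime T n (i + 1), γ x

/-- The integral of a nonnegative function over the cell with index `i`. -/
noncomputable def cellMass (f : ℝ → ℝ) (T : ℝ≥0) (n i : ℕ) : ℝ≥0 :=
  (∫ x in (obsTime T n i : ℝ)..obsTime T n (i + 1), f x).toNNReal

lemma PositiveLocallyBounded.coe_cellMass {f : ℝ → ℝ} (hf : PositiveLocallyBounded f) (T : ℝ≥0)
    (n i : ℕ) :
    (cellMass f T n i : ℝ) = ∫ x in (obsTime T n i : ℝ)..obsTime T n (i + 1), f x :=
  Real.coe_toNNReal _ (hf.integral_nonneg (obsTime_mono T n (Nat.le_succ i)))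

/-- Uniform continuity on `[0, T]`. The threshold sees `σ` at the right endpoint alone, while the
variance involves its values on the whole cell; an upper bound on these is what is required. -/
lemma eventually_volatility_le (hσ : ContinuousOn σ (Set.Ici 0)) {T : ℝ≥0} {δ : ℝ}
    (hδ : 0 < δ) : ∀ᶠ n : ℕ in atTop, ∀ i < n,
      ∀ x ∈ Set.Icc (obsTime T n i : ℝ) (obsTime T n (i + 1)),
        σ x ≤ σ (obsTime T n (i + 1)) + δ := by
  have hu := isCompact_Icc.uniformContinuousOn_of_continuous
    (hσ.mono (Set.Icc_subset_Ici_self : Set.Icc 0 (T : ℝ) ⊆ _))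
  obtain ⟨η, hη, hη'⟩ := Metric.uniformContinuousOn_iff.1 hu δ hδ
  filter_upwards [(tendsto_const_div_atTop_nhds_zero_nat (T : ℝ)).eventually_lt_const hη]
    with n hn i hi x hx
  have hle : (obsTime T n i : ℝ) ≤ obsTime T n (i + 1) := obsTime_mono T n (Nat.le_succ i)
  have hT : (obsTime T n (i + 1) : ℝ) ≤ T := obsTime_le T (by omega) hi
  have hlen : (obsTime T n (i + 1) : ℝ) - obsTime T n i = T / n := by
    rw [coe_obsTime, coe_obsTime]
    push_cast
    ring
  have h := hη' x ⟨(obsTime T n i).2.trans hx.1, hx.2.trans hT⟩ (obsTime T n (i + 1))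
    ⟨(obsTime T n (i + 1)).2, hT⟩ (by
      rw [Real.dist_eq, abs_sub_comm, abs_of_nonneg (by linarith [hx.2])]
      linarith [hx.1])
  rw [Real.dist_eq] at h
  linarith [le_abs_self (σ x - σ (obsTime T n (i + 1)))]

/-- `h` is negligible against `√(h log (1/h))`; this makes the drift harmless for the threshold. -/
lemma eventually_mul_mesh_le {T M δ : ℝ} (hT : 0 < T) (hδ : 0 < δ) :
    ∀ᶠ n : ℕ in atTop, M * (T / n) ≤ δ * √(T / n * Real.log (1 / (T / n))) := by
  have h1 : Tendsto (fun n : ℕ ↦ M ^ 2 * (T / n)) atTop (𝓝 0) := by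
    simpa using (tendsto_const_div_atTop_nhds_zero_nat T).const_mul (M ^ 2)
  filter_upwards [h1.eventually_le_const (show (0 : ℝ) < δ ^ 2 by positivity),
    (tendsto_log_mesh hT).eventually_ge_atTop 1] with n h2 h3
  have hh : 0 ≤ T / n := by positivity
  refine abs_le_of_sq_le_sq' ?_ (by positivity) |>.2
  rw [mul_pow, mul_pow, Real.sq_sqrt (by positivity)]
  nlinarith [mul_le_mul_of_nonneg_left h3 (mul_nonneg (sq_nonneg δ) hh)]

/-- Thresholds `√(c σ² h log (1 / h)) + r` with `c` bounded and bounded away from `2` from above, and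
negligible `r`, are admissible. -/
lemma exists_isAdmissibleThreshold (h : CoefficientConditions γ σ lam) {T : ℝ≥0} (hT : 0 < T)
    {c r : ℕ → ℕ → ℝ} {c₀ C₀ : ℝ} (hc₀ : 2 < c₀)
    (hc : ∀ᶠ n in atTop, ∀ i ∈ Finset.Icc 1 n, c₀ ≤ c n i ∧ c n i ≤ C₀)
    (hr : ∀ ε : ℝ, 0 < ε → ∀ᶠ n in atTop, ∀ i ∈ Finset.Icc 1 n, |r n i| ≤ ε * thresholdRate T n) :
    ∃ κ C' : ℝ, 2 < κ ∧ IsAdmissibleThreshold T κ C' (cellDrift γ T)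
      (cellMass (fun x ↦ σ x ^ 2) T)
      (fun n i ↦ √(c n (i + 1) * σ (obsTime T n (i + 1)) ^ 2 * mesh T n *
        Real.log (1 / mesh T n)) + r n (i + 1)) := by
  have hT' : (0 : ℝ) < T := hT
  obtain ⟨m, M, hm, hM⟩ := h.volatility_bounds T hT'
  obtain ⟨mγ, Mγ, hmγ, hMγ⟩ := h.drift_bounds T hT'
  have hMγ0 : 0 ≤ Mγ := hmγ.le.trans ((hMγ 0 ⟨le_rfl, hT'.le⟩).1.trans (hMγ 0 ⟨le_rfl, hT'.le⟩).2)
  have hM0 : 0 ≤ M := hm.le.trans ((hM 0 ⟨le_rfl, hT'.le⟩).1.trans (hM 0 ⟨le_rfl, hT'.le⟩).2)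
  obtain ⟨κ, hκ, hκc⟩ := exists_between hc₀
  have hsq : √κ < √c₀ := Real.sqrt_lt_sqrt (by linarith) hκc
  have hκ1 : 1 ≤ √κ := Real.one_le_sqrt.2 (by linarith)
  -- The gap between `√κ` and `√c₀` must absorb three errors of relative size `δ`: the oscillation
  -- of `σ` (weighted by `√κ`), the drift and the remainder `r`. This requires `δ (√κ + 2) ≤ (√c₀ -
  -- √κ) s`, and `m ≤ s`.
  let δ : ℝ := (√c₀ - √κ) * m / (√κ + 2)
  have hδ : 0 < δ := div_pos (mul_pos (sub_pos.2 hsq) hm) (by positivity)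
  have hδeq : δ * (√κ + 2) = (√c₀ - √κ) * m := div_mul_cancel₀ _ (by positivity)
  refine ⟨κ, √C₀ * M + δ, hκ, ?_⟩
  filter_upwards [hc, hr δ hδ, eventually_volatility_le h.volatility_continuous hδ,
    -- The bound `δ ℓ` on the drift serves the lower bound on the threshold; the bound `m ℓ` serves
    -- `g ≤ √(κ v l)`.
    eventually_mul_mesh_le hT' (lt_min hδ hm),
    (tendsto_log_mesh hT').eventually_ge_atTop 0] with n hcn hrn hσn hγn hl i hi
  have hi' : i + 1 ∈ Finset.Icc 1 n := Finset.mem_Icc.2 ⟨by omega, hi⟩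
  obtain ⟨hc1, hc2⟩ := hcn (i + 1) hi'
  have hr1 := hrn (i + 1) hi'
  rw [thresholdRate] at hr1
  rw [coe_mesh] at hr1 ⊢
  set hh : ℝ := (T : ℝ) / n with hhdef
  have hh0 : 0 ≤ hh := by positivity
  set l : ℝ := Real.log (1 / hh)
  set ℓ : ℝ := √(hh * l)
  have hℓ0 : 0 ≤ ℓ := Real.sqrt_nonneg _
  have hT1 : (obsTime T n (i + 1) : ℝ) ≤ T := obsTime_le T (by omega) hi
  obtain ⟨hσ1, hσ2⟩ := hM (obsTime T n (i + 1)) ⟨(obsTime T n (i + 1)).2, hT1⟩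
  set s : ℝ := σ (obsTime T n (i + 1))
  have hs0 : 0 ≤ s := hm.le.trans hσ1
  have hsqm := h.volatility_measurable.pow 2
  have hle : (obsTime T n i : ℝ) ≤ obsTime T n (i + 1) := obsTime_mono T n (Nat.le_succ i)
  have hlen : (obsTime T n (i + 1) : ℝ) - obsTime T n i = hh := by
    rw [coe_obsTime, coe_obsTime]
    push_cast
    ring
  have hvle : (cellMass (fun x ↦ σ x ^ 2) T n i : ℝ) ≤ (s + δ) ^ 2 * hh := by
    rw [h.volatility_bounds.sq.coe_cellMass]
    have := intervalIntegral.integral_mono_on hle (h.volatility_bounds.sq.intervalIntegrable hsqm _ _)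
      (intervalIntegrable_const (c := (s + δ) ^ 2)) fun x hx ↦ by
        have h0 : 0 ≤ σ x := hm.le.trans (hM x ⟨(obsTime T n i).2.trans hx.1, hx.2.trans hT1⟩).1
        have h1 := hσn i hi x hx
        change σ x ^ 2 ≤ (s + δ) ^ 2
        gcongr
    rwa [intervalIntegral.integral_const, hlen, smul_eq_mul, mul_comm] at this
  have hvge : m ^ 2 * hh ≤ (cellMass (fun x ↦ σ x ^ 2) T n i : ℝ) := by
    rw [h.volatility_bounds.sq.coe_cellMass]
    refine (h.volatility_bounds.sq.integral_bounds hsqm (M := M ^ 2) (fun x hx ↦ ?_) hi).1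
    obtain ⟨h1, h2⟩ := hM x hx
    have h0 := hm.le.trans h1
    exact ⟨by gcongr, by gcongr⟩
  have hg : cellDrift γ T n i ≤ min δ m * ℓ :=
    (h.drift_bounds.integral_bounds h.drift_measurable hMγ hi).2.trans hγn
  have hsqrt (k a : ℝ) (hk : 0 ≤ k) (ha : 0 ≤ a) : √(k * (a ^ 2 * hh) * l) = √k * a * ℓ := by
    rw [show k * (a ^ 2 * hh) * l = k * a ^ 2 * (hh * l) by ring, Real.sqrt_mul (by positivity),
      Real.sqrt_mul hk, Real.sqrt_sq ha]
  have hx1 : √(κ * cellMass (fun x ↦ σ x ^ 2) T n i * l) ≤ √κ * (s + δ) * ℓ := by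
    rw [← hsqrt κ (s + δ) (by linarith) (by positivity)]
    gcongr
  have hx2 : √κ * m * ℓ ≤ √(κ * cellMass (fun x ↦ σ x ^ 2) T n i * l) := by
    rw [← hsqrt κ m (by linarith) hm.le]
    gcongr
  have hy (c : ℝ) : √(c * s ^ 2 * hh * l) = √(c * (s ^ 2 * hh) * l) := by ring_nf
  have hy1 : √c₀ * s * ℓ ≤ √(c n (i + 1) * s ^ 2 * hh * l) := by
    rw [hy, ← hsqrt c₀ s (by linarith) hs0]
    gcongr
  have hy2 : √(c n (i + 1) * s ^ 2 * hh * l) ≤ √C₀ * M * ℓ := by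
    rw [hy, ← hsqrt C₀ M (by linarith) hM0]
    have : 0 ≤ C₀ := by linarith
    gcongr
  have hgδ : cellDrift γ T n i ≤ δ * ℓ :=
    hg.trans (mul_le_mul_of_nonneg_right (min_le_left _ _) hℓ0)
  have hgm : cellDrift γ T n i ≤ m * ℓ :=
    hg.trans (mul_le_mul_of_nonneg_right (min_le_right _ _) hℓ0)
  obtain ⟨hr2, hr3⟩ := abs_le.1 hr1
  refine ⟨?_, ?_, ?_⟩
  · have h1 : √κ * (s + δ) + δ ≤ √c₀ * s - δ := by nlinarith
    have h2 := mul_le_mul_of_nonneg_right h1 hℓ0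
    linarith
  · refine (hgm.trans ?_).trans hx2
    rw [mul_assoc]
    exact le_mul_of_one_le_left (by positivity) hκ1
  · linarith

end Threshold

end JumpDiffusion

namespace JumpDiffusion

/-! ### The increments of a jump diffusion as an array -/

section Array

lemma JumpDensityConditions.exists_bound {p : ℝ} {fp fm : ℝ → ℝ}
    (h : JumpDensityConditions p fp fm) :
    ∃ M : ℝ, 0 ≤ M ∧ ∀ x, mixtureDensity p fp fm x ≤ M := by
  obtain ⟨M₁, h1⟩ := h.bounded_pos
  obtain ⟨M₂, h2⟩ := h.bounded_neg
  obtain ⟨hp0, hp1⟩ := h.weight_mem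
  have hM₁ : 0 ≤ M₁ := (h.nonneg_pos 0 le_rfl).trans (h1 0 le_rfl)
  refine ⟨max M₁ M₂, le_max_of_le_left hM₁, fun x ↦ ?_⟩
  rw [mixtureDensity]
  split_ifs with hx
  · exact (mul_le_of_le_one_left (h.nonneg_pos x hx) hp1).trans ((h1 x hx).trans (le_max_left _ _))
  · have hx' := (not_le.1 hx).le
    exact (mul_le_of_le_one_left (h.nonneg_neg x hx') (by linarith)).trans
      ((h2 x hx').trans (le_max_right _ _))

variable {Ω : Type*} [MeasurableSpace Ω] {P : Measure Ω}

/-- The increment of a jump diffusion over `(s, t]` is a jump increment. -/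
lemma isJumpIncrement_sub {γ σ lam f : ℝ → ℝ} {M : ℝ} (hcoeff : CoefficientConditions γ σ lam)
    (hM : 0 ≤ M) (hf : ∀ x, f x ≤ M) {X W I : ℝ≥0 → Ω → ℝ} {N : ℝ≥0 → Ω → ℕ} {ζ : ℕ → Ω → ℝ}
    (hW : IsBrownianReal W P) (hI : IsWienerIntegral σ W I P) (hN : IsPoissonProcess lam N P)
    (hζm : ∀ j, Measurable (ζ j))
    (hζ : ∀ j, HasLaw (ζ j) (volume.withDensity fun x ↦ ENNReal.ofReal (f x)) P)
    (hind : IndepFun (fun ω t ↦ W t ω) (fun ω ↦ ((fun t ↦ N t ω), (fun j ↦ ζ j ω))) P)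
    (hind' : IndepFun (fun ω t ↦ N t ω) (fun ω j ↦ ζ j ω) P)
    (hX : ∀ t : ℝ≥0, ∀ᵐ ω ∂P,
      X t ω = (∫ u in (0 : ℝ)..t, γ u) + I t ω + ∑ j ∈ Finset.range (N t ω), ζ j ω)
    {s t : ℝ≥0} (hst : s ≤ t) :
    IsJumpIncrement P (fun ω ↦ I t ω - I s ω) (N s) (N t) ζ (∫ u in (s : ℝ)..t, γ u)
      (∫ u in (s : ℝ)..t, σ u ^ 2).toNNReal (∫ u in (s : ℝ)..t, lam u).toNNReal M
      (fun ω ↦ X t ω - X s ω) where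
  law_gauss := by
    rw [intervalIntegral.integral_of_le (NNReal.coe_le_coe.2 hst)]
    exact hI.hasLaw_increment hW.toIsPreBrownianReal hcoeff.volatility_memLp hst
  measurable_left := hN.measurable s
  measurable_right := hN.measurable t
  measurable_jump := hζm
  indep_gauss := by
    -- Independence is assumed for `W`, not for its integral; it passes to `I t - I s` as an almost
    -- sure functional of the path of `W`.
    obtain ⟨F, hF, hF'⟩ := hI.exists_increment_eq_comp hW.toIsPreBrownianReal s t
    exact (hind.comp hF (ψ := fun q : (ℝ≥0 → ℕ) × (ℕ → ℝ) ↦ ((q.1 s, q.1 t), q.2))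
      (by fun_prop)).congr hF'.symm .rfl
  indep_jump := hind'.comp (φ := fun x : ℝ≥0 → ℕ ↦ (x s, x t)) (by fun_prop) measurable_id
  law_count := hN.hasLaw s t hst
  bound_nonneg := hM
  small_ball j x B := measure_abs_add_le_of_density hf hM (hζ j) B x
  eq := by
    have hγ := hcoeff.drift_bounds.intervalIntegrable hcoeff.drift_measurable
    filter_upwards [hX s, hX t] with ω h1 h2
    have h3 := intervalIntegral.integral_add_adjacent_intervals (hγ 0 s) (hγ s t)
    rw [NNReal.coe_zero] at h3
    rw [h1, h2, ← h3]
    ring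

/-- The increments of a jump diffusion over the cells of length `T / n` form an increment array. -/
lemma exists_isIncrementArray [IsProbabilityMeasure P] {γ σ lam : ℝ → ℝ} {p : ℝ} {fp fm : ℝ → ℝ}
    {X : ℝ≥0 → Ω → ℝ} (hcoeff : CoefficientConditions γ σ lam)
    (hdens : JumpDensityConditions p fp fm)
    (hX : IsJumpDiffusion γ σ lam (mixtureDensity p fp fm) X P) {T : ℝ≥0} (hT : 0 < T) :
    ∃ (G : ℕ → ℕ → Ω → ℝ) (count : ℕ → ℕ → Ω → ℕ) (ζ : ℕ → Ω → ℝ) (M C : ℝ) (total : Ω → ℝ),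
      IsIncrementArray P T G count ζ (cellDrift γ T) (cellMass (fun x ↦ σ x ^ 2) T)
        (cellMass lam T) M C
        (fun n i ω ↦ X (obsTime T n (i + 1)) ω - X (obsTime T n i) ω) total := by
  obtain ⟨W, I, N, ζ, -, hW, hI, hN, hζm, -, hζ, hind, hind', hX⟩ := hX
  obtain ⟨M, hM, hf⟩ := hdens.exists_bound
  have hT' : (0 : ℝ) < T := hT
  obtain ⟨m₁, M₁, hm₁, hM₁⟩ := hcoeff.drift_bounds T hT'
  obtain ⟨m₂, M₂, hm₂, hM₂⟩ := hcoeff.volatility_bounds.sq T hT'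
  obtain ⟨m₃, M₃, hm₃, hM₃⟩ := hcoeff.intensity_bounds T hT'
  have hσm := hcoeff.volatility_measurable.pow 2
  have hmono (n i : ℕ) : obsTime T n i ≤ obsTime T n (i + 1) := obsTime_mono T n (Nat.le_succ i)
  have hle (n : ℕ) {A : ℝ} (hA : A ≤ max M₁ (max M₂ M₃)) :
      A * ((T : ℝ) / n) ≤ max M₁ (max M₂ M₃) * (T / n) := by gcongr
  refine ⟨fun n i ω ↦ I (obsTime T n (i + 1)) ω - I (obsTime T n i) ω, fun n i ↦ N (obsTime T n i),
    ζ, M, max M₁ (max M₂ M₃), fun ω ↦ (N T ω : ℝ) - N 0 ω, ?_⟩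
  exact
    { increment := fun n i ↦ isJumpIncrement_sub hcoeff hM hf hW hI hN hζm hζ hind hind' hX
        (hmono n i)
      -- `i < j` means `i + 1 ≤ j`: cell `i` ends no later than cell `j` begins.
      indep := fun n i j hij ↦ hI.indepFun_increments hW.toIsPreBrownianReal
        hcoeff.volatility_memLp (hmono n i) (obsTime_mono T n hij) (hmono n j)
      count_mono := fun n ↦ hN.monotone.mono fun ω hω ↦ hω.comp (obsTime_mono T n)
      count_le := fun n hn ↦ .of_forall fun ω ↦ by simp only [obsTime_self T hn, obsTime_zero, le_rfl]
      total_memLp := memLp_of_hasLaw_poisson (hN.hasLaw 0 T zero_le)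
      drift_nonneg := fun n i _ ↦ hcoeff.drift_bounds.integral_nonneg (hmono n i)
      drift_le := fun n i hi ↦ (hcoeff.drift_bounds.integral_bounds hcoeff.drift_measurable
        hM₁ hi).2.trans (hle n (by simp))
      var_ne_zero := fun n i hi ↦ by
        have hn : (0 : ℝ) < n := by exact_mod_cast (by omega : 0 < n)
        refine (NNReal.coe_pos.1 ?_).ne'
        rw [hcoeff.volatility_bounds.sq.coe_cellMass]
        exact lt_of_lt_of_le (by positivity)
          (hcoeff.volatility_bounds.sq.integral_bounds hσm hM₂ hi).1
      var_le := fun n i hi ↦ by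
        rw [hcoeff.volatility_bounds.sq.coe_cellMass]
        exact (hcoeff.volatility_bounds.sq.integral_bounds hσm hM₂ hi).2.trans (hle n (by simp))
      intensity_le := fun n i hi ↦ by
        rw [hcoeff.intensity_bounds.coe_cellMass]
        exact (hcoeff.intensity_bounds.integral_bounds hcoeff.intensity_measurable hM₃ hi).2.trans
          (hle n (by simp)) }

end Array

/-! ### Asymptotics of the thresholded realized variance -/

section Asymptotics

variable {Ω : Type*} [MeasurableSpace Ω] {P : Measure Ω} {γ σ lam : ℝ → ℝ}

lemma PositiveLocallyBounded.sum_cellMass {f : ℝ → ℝ} (hf : PositiveLocallyBounded f)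
    (hm : AEStronglyMeasurable f (volume.restrict (Set.Ici 0))) (T : ℝ≥0) {n : ℕ} (hn : 0 < n) :
    ∑ i ∈ Finset.range n, (cellMass f T n i : ℝ) = ∫ x in (0 : ℝ)..T, f x := by
  simp only [hf.coe_cellMass]
  rw [intervalIntegral.sum_integral_adjacent_intervals (a := fun i ↦ (obsTime T n i : ℝ))
    fun i _ ↦ hf.intervalIntegrable hm _ _, obsTime_self T hn, obsTime_zero, NNReal.coe_zero]

lemma PositiveLocallyBounded.mul {f g : ℝ → ℝ} (hf : PositiveLocallyBounded f)
    (hg : PositiveLocallyBounded g) : PositiveLocallyBounded fun x ↦ f x * g x := fun t ht ↦ by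
  obtain ⟨m, M, hm, hM⟩ := hf t ht
  obtain ⟨m', M', hm', hM'⟩ := hg t ht
  refine ⟨m * m', M * M', mul_pos hm hm', fun s hs ↦ ?_⟩
  obtain ⟨h1, h2⟩ := hM s hs
  obtain ⟨h3, h4⟩ := hM' s hs
  exact ⟨mul_le_mul h1 h3 hm'.le (hm.le.trans h1),
    mul_le_mul h2 h4 (hm'.le.trans h3) (hm.le.trans (h1.trans h2))⟩

lemma PositiveLocallyBounded.integral_pos {f : ℝ → ℝ} (hf : PositiveLocallyBounded f)
    (hm : AEStronglyMeasurable f (volume.restrict (Set.Ici 0))) {T : ℝ≥0} (hT : 0 < T) :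
    0 < ∫ x in (0 : ℝ)..T, f x := by
  obtain ⟨m, M, hm0, hM⟩ := hf T hT
  -- For `n = 1` the only cell is the whole of `[0, T]`.
  have := (hf.integral_bounds hm hM one_pos).1
  rw [zero_add, obsTime_self T one_pos, obsTime_zero, NNReal.coe_zero, Nat.cast_one, div_one] at this
  exact (mul_pos hm0 hT).trans_le this

/-- Asymptotics of the thresholded realized variance for admissible thresholds. -/
theorem trvAsymptotics_of_isAdmissibleThreshold [IsProbabilityMeasure P] {p : ℝ} {fp fm : ℝ → ℝ}
    {X : ℝ≥0 → Ω → ℝ} (hcoeff : CoefficientConditions γ σ lam)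
    (hdens : JumpDensityConditions p fp fm)
    (hX : IsJumpDiffusion γ σ lam (mixtureDensity p fp fm) X P) {T : ℝ≥0} (hT : 0 < T)
    {B : ℕ → ℕ → ℝ} {κ C' : ℝ} (hκ : 2 < κ)
    (hB : IsAdmissibleThreshold T κ C' (cellDrift γ T) (cellMass (fun x ↦ σ x ^ 2) T)
      fun n i ↦ B n (i + 1)) :
    TRVAsymptotics γ σ lam X P T B := by
  obtain ⟨G, count, ζ, M, C, total, h⟩ := exists_isIncrementArray hcoeff hdens hX hT
  have hT' : (0 : ℝ) < T := hT
  have hσ2 := hcoeff.volatility_bounds.sq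
  have hσm := hcoeff.volatility_measurable.pow 2
  have hγ := hcoeff.drift_bounds
  have hγm := hcoeff.drift_measurable
  have hl := hcoeff.intensity_bounds
  have hlm := hcoeff.intensity_measurable
  have hlim1 := tendsto_sum_increments hγ hγm hγ hγm hT
  have hlim2 := tendsto_sum_increments hl hlm hσ2 hσm hT
  have hlim3 := tendsto_sum_increments hσ2 hσm hσ2 hσm hT
  simp only [← hl.coe_cellMass, ← hσ2.coe_cellMass, ← sq] at hlim1 hlim2 hlim3
  have hK : ∫ s in (0 : ℝ)..T, (γ s ^ 2 - lam s * σ s ^ 2) =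
      (∫ s in (0 : ℝ)..T, γ s ^ 2) - ∫ s in (0 : ℝ)..T, lam s * σ s ^ 2 :=
    intervalIntegral.integral_sub (by simpa using hγ.sq.intervalIntegrable (hγm.pow 2) 0 T)
      (by simpa using (hl.mul hσ2).intervalIntegrable (hlm.mul hσm) 0 T)
  have hbias := h.tendsto_bias hT' hκ hB (fun n hn ↦ hσ2.sum_cellMass hσm T hn) hlim1 hlim2
  rw [← hK] at hbias
  have hvar := h.tendsto_variance hT' hκ hB hlim3
  have htrv (n : ℕ) : trv X T n (B n) = fun ω ↦ ∑ i ∈ Finset.range n,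
      truncSq (B n (i + 1)) (X (obsTime T n (i + 1)) ω - X (obsTime T n i) ω) := rfl
  have hbias' : Tendsto (fun n ↦ trvBias σ X P T B n / (mesh T n : ℝ)) atTop
      (𝓝 (∫ s in (0 : ℝ)..T, (γ s ^ 2 - lam s * σ s ^ 2))) := by
    simpa only [trvBias, htrv, coe_mesh] using hbias
  have hmesh : ∀ᶠ n : ℕ in atTop, (mesh T n : ℝ) ≠ 0 := by
    filter_upwards [eventually_gt_atTop 0] with n hn
    rw [coe_mesh]
    positivity
  refine ⟨fun n ↦ ?_, fun hK0 ↦ ?_, ?_, ?_⟩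
  · exact h.memLp_sum_truncSq (fun n i ↦ B n (i + 1)) n
  · have := hbias'.div_const (∫ s in (0 : ℝ)..T, (γ s ^ 2 - lam s * σ s ^ 2))
    rw [div_self hK0] at this
    simpa only [AsympEquiv, div_div] using this
  · rw [Asymptotics.isLittleO_iff_tendsto' (hmesh.mono fun n hn h0 ↦ absurd h0 hn)]
    have := hbias'.sub_const (∫ s in (0 : ℝ)..T, (γ s ^ 2 - lam s * σ s ^ 2))
    rw [sub_self] at this
    refine this.congr' (hmesh.mono fun n hn ↦ ?_)
    beta_reduce
    rw [sub_div, mul_div_cancel_left₀ _ hn]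
  · have h4 : ∫ s in (0 : ℝ)..T, (σ s ^ 2) ^ 2 = ∫ s in (0 : ℝ)..T, σ s ^ 4 := by
      simp only [← pow_mul]
    have hpos := hσ2.sq.integral_pos (hσm.pow 2) hT
    have hvar' := hvar.div_const (2 * ∫ s in (0 : ℝ)..T, (σ s ^ 2) ^ 2)
    rw [div_self (by positivity), h4] at hvar'
    rw [AsympEquiv]
    refine hvar'.congr fun n ↦ ?_
    rw [htrv, coe_mesh, div_div]
    congr 1
    ring

lemma trvAsymptotics_of_eventually_bounds [IsProbabilityMeasure P] {p : ℝ} {fp fm : ℝ → ℝ}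
    {X : ℝ≥0 → Ω → ℝ} (hcoeff : CoefficientConditions γ σ lam)
    (hdens : JumpDensityConditions p fp fm)
    (hX : IsJumpDiffusion γ σ lam (mixtureDensity p fp fm) X P) {T : ℝ≥0} (hT : 0 < T)
    {c r : ℕ → ℕ → ℝ} {c₀ C₀ : ℝ} (hc₀ : 2 < c₀)
    (hc : ∀ᶠ n in atTop, ∀ i ∈ Finset.Icc 1 n, c₀ ≤ c n i ∧ c n i ≤ C₀)
    (hr : ∀ ε : ℝ, 0 < ε → ∀ᶠ n in atTop, ∀ i ∈ Finset.Icc 1 n, |r n i| ≤ ε * thresholdRate T n) :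
    TRVAsymptotics γ σ lam X P T
      (fun n i ↦ √(c n i * σ (obsTime T n i) ^ 2 * mesh T n * Real.log (1 / mesh T n)) + r n i) := by
  obtain ⟨κ, C', hκ, hB⟩ := exists_isAdmissibleThreshold hcoeff hT hc₀ hc hr
  exact trvAsymptotics_of_isAdmissibleThreshold hcoeff hdens hX hT hκ hB

end Asymptotics

end JumpDiffusion

theorem mainTheorem5 {Ω : Type*} [MeasurableSpace Ω] (P : Measure Ω) [IsProbabilityMeasure P]
    (γ σ lam : ℝ → ℝ) (p : ℝ) (fp fm : ℝ → ℝ) (X : ℝ≥0 → Ω → ℝ)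
    (hcoeff : JumpDiffusion.CoefficientConditions γ σ lam)
    (hdens : JumpDiffusion.JumpDensityConditions p fp fm)
    (hX : JumpDiffusion.IsJumpDiffusion γ σ lam (JumpDiffusion.mixtureDensity p fp fm) X P)
    (T : ℝ≥0) (hT : 0 < T) :
    JumpDiffusion.TRVAsymptotics γ σ lam X P T
      (fun n i ↦ √(3 * σ (JumpDiffusion.obsTime T n i) ^ 2 * JumpDiffusion.mesh T n *
        Real.log (1 / JumpDiffusion.mesh T n))) ∧
    ∀ c r : ℕ → ℕ → ℝ,
      (2 : EReal) < liminf (fun n ↦ ⨅ i ∈ Finset.Icc 1 n, (c n i : EReal)) atTop →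
      limsup (fun n ↦ ⨆ i ∈ Finset.Icc 1 n, (c n i : EReal)) atTop < ⊤ →
      (∀ ε : ℝ, 0 < ε → ∀ᶠ n in atTop, ∀ i ∈ Finset.Icc 1 n,
        |r n i| ≤ ε * JumpDiffusion.thresholdRate T n) →
      JumpDiffusion.TRVAsymptotics γ σ lam X P T
        (fun n i ↦ √(c n i * σ (JumpDiffusion.obsTime T n i) ^ 2 * JumpDiffusion.mesh T n *
          Real.log (1 / JumpDiffusion.mesh T n)) + r n i) := by
  refine ⟨?_, fun c r hc hc' hr ↦ ?_⟩
  · have := JumpDiffusion.trvAsymptotics_of_eventually_bounds hcoeff hdens hX hT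
      (c := fun _ _ ↦ 3) (r := fun _ _ ↦ 0) (c₀ := 3) (C₀ := 3) (by norm_num)
      (.of_forall fun _ _ _ ↦ ⟨le_rfl, le_rfl⟩)
      fun ε hε ↦ .of_forall fun n i _ ↦ by
        rw [abs_zero]
        exact mul_nonneg hε.le (Real.sqrt_nonneg _)
    simpa only [add_zero] using this
  -- The strict inequalities in the extended reals leave room for real bounds `c₀ > 2` and `C₀`,
  -- valid for all `c n i` with `n` large.
  · obtain ⟨c₀, hc₀, hc₀'⟩ := EReal.lt_iff_exists_real_btwn.1 hc
    obtain ⟨C₀, hC₀, -⟩ := EReal.lt_iff_exists_real_btwn.1 hc'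
    refine JumpDiffusion.trvAsymptotics_of_eventually_bounds hcoeff hdens hX hT
      (c₀ := c₀) (C₀ := C₀) (EReal.coe_lt_coe_iff.1 hc₀) ?_ hr
    filter_upwards [eventually_lt_of_lt_liminf hc₀', eventually_lt_of_limsup_lt hC₀]
      with n h1 h2 i hi
    exact ⟨EReal.coe_le_coe_iff.1 (h1.le.trans (iInf₂_le i hi)),
      EReal.coe_le_coe_iff.1 ((le_iSup₂ (f := fun i _ ↦ (c n i : EReal)) i hi).trans h2.le)⟩
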